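/- **Setting.** Let $R$ be a partially ordered commutative ring (for instance $\mathbb Z$, or $\mathbb Z[\beta]$ ordered coefficientwise) and let $\beta\in R$. A *weak composition* is a sequence $\gamma=(\gamma_1,\gamma_2,\dots)$ of nonnegative integers with finitely many nonzero terms (finite sequences are identified if they differ only by zeros at the end), and $|\gamma|=\sum_i\gamma_i$. Let $\gamma^+$ be the sequence obtained from $\gamma$ by deleting all zeros (a *composition*), and let $\lambda(\gamma)$ be the weakly decreasing rearrangement of $\gamma$ (a *partition*). A *set-valued filling* $F$ of shape $\gamma$ puts a nonempty finite set of positive integers in each box of the left-justified diagram with $\gamma_i$ boxes in row $i$ (rows numbered from top to bottom, columns from $1$). The maximum of a box is its *anchor* entry, the other entries are *free*. Let $x^F=\prod_j x_j^{m_j}$ where $m_j$ is the number of boxes containing $j$, and $|F|=\sum_j m_j$. Add a column $0$ (the basement) with entry $i$ in row $i$; it does not count in $x^F$ and $|F|$, and its entries count as anchors. $F$ is a *semistandard set-valued skyline filling*, $F\in \mathsf{SetSkyFill}(\gamma)$, if 1. no number occurs in two boxes of the same column; 2. rows, including the basement, weakly decrease: the minimum of a box is at least the maximum of the next box on its right;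 3. for all rows $i<j$ and all columns $k\ge 0$, the anchors $a,b,c$ in the following boxes satisfy $b>c\ge a$ or $c\ge a>b$: if $\gamma_i\ge\gamma_j$ and $k+1\le \gamma_j$, take $c,a,b$ in boxes $(i,k),(i,k+1),(j,k+1)$; if $\gamma_i<\gamma_j$ and $k\le\gamma_i$, take $b,c,a$ in boxes $(i,k),(j,k),(j,k+1)$; 4. every free entry $x$ of a box $(i,k)$ is in the highest possible row: there is no $i'<i$ such that box $(i',k)$ exists and $x$ could be put into it as a free entry (that is, $x$ is less than the anchor of $(i',k)$) with row $i'$ still weakly decreasing. A *set-valued reverse tableau* of partition shape $\lambda$ is a set-valued filling of shape $\lambda$ (no basement) whose rows weakly decrease (in the sense of 2) and whose columns strictly decrease from top to bottom (the minimum of a box exceeds the maximum of the box below); $\mathsf{SetRT}(\lambda)$ is the set of them. Define the formal power series in $x_1,x_2,\dots$ over $R$ $$\mathcal L_\gamma=\sum_{F\in\mathsf{SetSkyFill}(\gamma)}\beta^{|F|-|\gamma|}x^F,\qquad \mathcal G_\alpha=\sum_{\gamma^+=\alpha}\mathcal L_\gamma,\qquad G_\lambda=\sum_{T\in\mathsf{SetRT}(\lambda)}\beta^{|T|-|\lambda|}x^T$$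 for weak compositions $\gamma$, compositions $\alpha$ and partitions $\lambda$. Infinite sums are formal: each monomial occurs in finitely many terms. A power series $f$ is *symmetric* if it is invariant under permutations of the variables, and *quasisymmetric* if $[x_{i_1}^{\alpha_1}\cdots x_{i_k}^{\alpha_k}]f=[x_1^{\alpha_1}\cdots x_k^{\alpha_k}]f$ for all positive integers $\alpha_1,\dots,\alpha_k$ and $i_1<\dots<i_k$. For a family $(g_i)$ of power series, $f$ is *$g_i$-positive* if $f=\sum_i a_i g_i$ for some (possibly infinitely many nonzero) $a_i\ge 0$ in $R$. **Proposition.** Suppose $f=\sum_\gamma c_\gamma\mathcal L_\gamma$, a (possibly infinite) sum over all weak compositions with $c_\gamma\in R$. Then 1. $f$ is quasisymmetric if and only if $c_\gamma=c_\delta$ for all $\gamma,\delta$ with $\gamma^+=\delta^+$; 2. $f$ is symmetric if and only if $c_\gamma=c_\delta$ for all $\gamma,\delta$ with $\lambda(\gamma)=\lambda(\delta)$. Furthermore, if $f$ is quasisymmetric, then $f$ is $\mathcal G_\alpha$-positive if and only if it is $\mathcal L_\gamma$-positive; and if $f$ is symmetric, then $f$ is $G_\lambda$-positive if and only if it is $\mathcal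 L_\gamma$-positive. -/

import Mathlib

/-! Conventions.  Rows of diagrams, entries of fillings and variables are indexed by `ℕ` starting
at `0`: the index `i` stands for row `i + 1`, for the entry `i + 1` and for the variable `x_{i+1}`.
Formal power series in `x₁, x₂, …` over `R` are `MvPowerSeries ℕ R`. -/

namespace Skyline

/-- A weak composition; it is identified with those obtained by adding or removing zero parts
at its end, which do not affect any of the power series below. -/
abbrev WeakComp := ℕ →₀ ℕ

/-- The list of nonzero parts of `γ`, in order: the composition `γ⁺`. -/
def plus (γ : WeakComp) : List ℕ := (γ.support.sort (· ≤ ·)).map γ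

/-- Compositions: finite sequences of positive integers. -/
abbrev Comp := {α : List ℕ // ∀ a ∈ α, 0 < a}

/-- Partitions: weakly decreasing weak compositions. -/
abbrev Partition := {lam : WeakComp // Antitone lam}

/-- The partition `λ(γ)`: the parts of `γ` rearranged into weakly decreasing order. -/
def sortParts (γ : WeakComp) : WeakComp :=
  ((γ.support.val.map γ).sort (· ≥ ·)).toFinsupp

theorem sortParts_antitone (γ : WeakComp) : Antitone (sortParts γ) := by
  intro a b hab
  have hp := Multiset.pairwise_sort (γ.support.val.map γ) (· ≥ ·)
  simp only [sortParts, List.toFinsupp_apply]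
  set l := (γ.support.val.map γ).sort (· ≥ ·)
  rcases lt_or_ge b l.length with hb | hb
  · rw [List.getD_eq_getElem _ _ hb, List.getD_eq_getElem _ _ (lt_of_le_of_lt hab hb)]
    rcases hab.eq_or_lt with rfl | h
    · exact le_rfl
    · exact List.pairwise_iff_getElem.1 hp a b _ _ h
  · rw [List.getD_eq_default _ _ hb]
    exact Nat.zero_le _

/-- The partition `λ(γ)`. -/
def partitionOf (γ : WeakComp) : Partition := ⟨sortParts γ, sortParts_antitone γ⟩

/-- A set-valued filling of the left-justified diagram with `γ i` boxes in row `i`: a nonempty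
finite set `entries i k` in each box `k < γ i` of row `i`; positions outside the diagram carry
the empty set.  (The basement is not part of the filling.) -/
@[ext]
structure SetFilling (γ : WeakComp) where
  entries : ℕ → ℕ → Finset ℕ
  nonempty_iff : ∀ i k, (entries i k).Nonempty ↔ k < γ i

namespace SetFilling

variable {γ : WeakComp}

/-- The content: `content F j` is the number of occurrences of `j` in the boxes of `F`
(basement excluded). -/
noncomputable def content (F : SetFilling γ) : WeakComp :=
  ∑ i ∈ γ.support, ∑ k ∈ Finset.range (γ i), ∑ j ∈ F.entries i k, Finsupp.single j 1

/-- The box in row `i` and column `k` of the filled skyline diagram with basement `b_i = i`: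
column `0` is the basement, column `k + 1` is the `k`-th column of the filling. -/
def box (F : SetFilling γ) (i : ℕ) : ℕ → Finset ℕ
  | 0 => {i}
  | k + 1 => F.entries i k

/-- The anchor entry, that is the maximum, of a (nonempty) box. -/
def anchor (F : SetFilling γ) (i k : ℕ) : ℕ := (F.box i k).sup id

end SetFilling

/-- Inversion triples. -/
def IsInversionTriple (a b c : ℕ) : Prop := (c < b ∧ a ≤ c) ∨ (a ≤ c ∧ b < a)

/-- Semistandard set-valued skyline fillings with basement `b_i = i`. -/
structure IsSemistandardSkyline {γ : WeakComp} (F : SetFilling γ) : Prop where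
  /-- Entries do not repeat in a column. -/
  column : ∀ i j k, i ≠ j → Disjoint (F.box i k) (F.box j k)
  /-- Rows, including the basement, are weakly decreasing: each box has minimum at least the
  maximum of the next box. -/
  row : ∀ i k, ∀ x ∈ F.box i k, ∀ y ∈ F.box i (k + 1), y ≤ x
  /-- Type A triples of anchor entries (row `i` above row `j`, with `γ i ≥ γ j`): `c` and `a` are
  adjacent in row `i`, and `b` is in row `j` below `a`. -/
  tripleA : ∀ i j k, i < j → γ j ≤ γ i → k + 1 ≤ γ j →
    IsInversionTriple (F.anchor i (k + 1)) (F.anchor j (k + 1)) (F.anchor i k)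
  /-- Type B triples of anchor entries (row `i` above row `j`, with `γ i < γ j`): `c` and `a` are
  adjacent in row `j`, and `b` is in row `i` above `c`. -/
  tripleB : ∀ i j k, i < j → γ i < γ j → k ≤ γ i →
    IsInversionTriple (F.anchor j (k + 1)) (F.anchor i k) (F.anchor j k)
  /-- Each free entry `x` is in the highest possible row of its column: there is no higher row
  `i'` where `x` could be put in the same column as a free entry (`x` less than the anchor) with
  the row staying weakly decreasing. -/
  free : ∀ i k, ∀ x ∈ F.box i (k + 1), x < F.anchor i (k + 1) → ∀ i' < i,
    ¬ (k + 1 ≤ γ i' ∧ x < F.anchor i' (k + 1) ∧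
      (∀ y ∈ F.box i' k, x ≤ y) ∧ (∀ y ∈ F.box i' (k + 2), y ≤ x))

/-- Set-valued reverse tableaux: set-valued fillings with weakly decreasing rows and strictly
decreasing columns. -/
structure IsReverseTableau {lam : WeakComp} (T : SetFilling lam) : Prop where
  row : ∀ i k, ∀ x ∈ T.entries i k, ∀ y ∈ T.entries i (k + 1), y ≤ x
  column : ∀ i k, ∀ x ∈ T.entries i k, ∀ y ∈ T.entries (i + 1) k, y < x

/-- The set `SetSkyFill(γ)`. -/
abbrev SetSkyFill (γ : WeakComp) := {F : SetFilling γ // IsSemistandardSkyline F}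

/-- The set `SetRT(λ)`. -/
abbrev SetRT (lam : WeakComp) := {T : SetFilling lam // IsReverseTableau T}

/-! The sums below are well defined: every monomial occurs in finitely many of their terms. -/

theorem mem_support_content {γ : WeakComp} (F : SetFilling γ) {i k j : ℕ}
    (h : j ∈ F.entries i k) : j ∈ F.content.support := by
  have hk : k < γ i := (F.nonempty_iff i k).1 ⟨j, h⟩
  have hi : i ∈ γ.support := Finsupp.mem_support_iff.2 (by omega)
  have h1 : Finsupp.single j 1 ≤ F.content := by
    calc Finsupp.single j 1 ≤ ∑ j ∈ F.entries i k, Finsupp.single j 1 :=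
          Finset.single_le_sum (f := fun j => Finsupp.single j 1) (fun _ _ => zero_le) h
      _ ≤ ∑ k ∈ Finset.range (γ i), ∑ j ∈ F.entries i k, Finsupp.single j 1 :=
          Finset.single_le_sum (f := fun k => ∑ j ∈ F.entries i k, Finsupp.single j 1)
            (fun _ _ => zero_le) (Finset.mem_range.2 hk)
      _ ≤ F.content :=
          Finset.single_le_sum (f := fun i => ∑ k ∈ Finset.range (γ i),
            ∑ j ∈ F.entries i k, Finsupp.single j 1) (fun _ _ => zero_le) hi
  have := h1 j
  rw [Finsupp.single_eq_same] at this
  exact Finsupp.mem_support_iff.2 (by omega)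

theorem degree_le_degree_content {γ : WeakComp} (F : SetFilling γ) :
    γ.degree ≤ F.content.degree := by
  rw [SetFilling.content, map_sum, Finsupp.degree_apply]
  refine Finset.sum_le_sum fun i _ => ?_
  rw [map_sum]
  calc γ i = ∑ k ∈ Finset.range (γ i), 1 := by simp
    _ ≤ _ := by
      refine Finset.sum_le_sum fun k hk => ?_
      rw [map_sum]
      simpa using (F.nonempty_iff i k).2 (Finset.mem_range.1 hk)

theorem finite_content_eq (γ m : WeakComp) : Finite {F : SetFilling γ // F.content = m} := by
  let φ : {F : SetFilling γ // F.content = m} →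
      ((i : γ.support) → Fin (γ i) → m.support.powerset) := fun F i k =>
    ⟨F.1.entries i k, Finset.mem_powerset.2 fun j hj => F.2 ▸ mem_support_content F.1 hj⟩
  refine Finite.of_injective φ ?_
  rintro ⟨F, hF⟩ ⟨F', hF'⟩ h
  refine Subtype.ext (SetFilling.ext ?_)
  funext i k
  by_cases hk : k < γ i
  · have hi : i ∈ γ.support := Finsupp.mem_support_iff.2 (by omega)
    exact congrArg Subtype.val (congrFun (congrFun h ⟨i, hi⟩) ⟨k, hk⟩)
  · have h1 := mt (F.nonempty_iff i k).1 hk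
    have h2 := mt (F'.nonempty_iff i k).1 hk
    rw [Finset.not_nonempty_iff_eq_empty] at h1 h2
    exact h1.trans h2.symm

theorem mem_firstColumn {γ : WeakComp} {F : SetFilling γ} (hF : IsSemistandardSkyline F) :
    ∀ i, 0 < γ i → i ∈ F.entries i 0 ∧ F.anchor i 1 = i := by
  intro i
  induction i using Nat.strong_induction_on with
  | _ i ih =>
    intro hi
    obtain ⟨x, hx, hxa⟩ := Finset.exists_mem_eq_sup _ ((F.nonempty_iff i 0).2 hi) id
    have hanch : F.anchor i 1 = x := hxa
    have hle : x ≤ i := hF.row i 0 i (by simp [SetFilling.box]) x hx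
    rcases hle.eq_or_lt with rfl | hlt
    · exact ⟨hx, hanch⟩
    · exfalso
      have h0 : ∀ j, F.anchor j 0 = j := fun j => by simp [SetFilling.anchor, SetFilling.box]
      rcases lt_or_ge (γ x) (γ i) with h | h
      · have := hF.tripleB x i 0 hlt h (Nat.zero_le _)
        rw [h0, h0, zero_add, hanch, IsInversionTriple] at this
        omega
      · exact Finset.disjoint_left.1 (hF.column x i 1 hlt.ne) (ih x hlt (by omega)).1 hx

section Series

variable {R : Type*} [CommRing R]

/-- `f = ∑ i, g i` as formal power series: every monomial occurs in only finitely many of the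
`g i`, and its coefficient in `f` is the sum of its coefficients in the `g i`. -/
def HasFormalSum {ι : Type*} (g : ι → MvPowerSeries ℕ R) (f : MvPowerSeries ℕ R) : Prop :=
  ∀ m : ℕ →₀ ℕ, (Function.support fun i => MvPowerSeries.coeff m (g i)).Finite ∧
    MvPowerSeries.coeff m f = ∑ᶠ i, MvPowerSeries.coeff m (g i)

/-- The formal sum `∑ i, g i`, computed coefficient by coefficient; it is used only for families
in which every monomial occurs finitely often. -/
noncomputable def formalSum {ι : Type*} (g : ι → MvPowerSeries ℕ R) : MvPowerSeries ℕ R :=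
  fun m => ∑ᶠ i, MvPowerSeries.coeff m (g i)

/-- The term `β ^ (|F| - |γ|) x ^ F` of a set-valued filling `F` of shape `γ`. -/
noncomputable def fillingTerm (β : R) {γ : WeakComp} (F : SetFilling γ) : MvPowerSeries ℕ R :=
  MvPowerSeries.monomial F.content (β ^ (F.content.degree - γ.degree))

/-- The combinatorial Lascoux atom `𝓛_γ`. -/
noncomputable def lascouxAtom (β : R) (γ : WeakComp) : MvPowerSeries ℕ R :=
  formalSum fun F : SetSkyFill γ => fillingTerm β F.1

theorem coeff_fillingTerm_support (β : R) {γ : WeakComp} (P : SetFilling γ → Prop) (m : ℕ →₀ ℕ) :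
    (Function.support fun F : {F : SetFilling γ // P F} =>
      MvPowerSeries.coeff m (fillingTerm β F.1)).Finite := by
  have := finite_content_eq γ m
  have h : ∀ F : {F : {F : SetFilling γ // P F} // F.1.content = m}, F.1.1.content = m :=
    fun F => F.2
  have hfin : {F : {F : SetFilling γ // P F} | F.1.content = m}.Finite := by
    refine Set.finite_coe_iff.1 ?_
    exact Finite.of_injective (fun F => (⟨F.1.1, h F⟩ : {F : SetFilling γ // F.content = m}))
      fun F F' e => Subtype.ext (Subtype.ext (Subtype.mk.inj e))
  refine hfin.subset fun F hF => ?_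
  by_contra hne
  exact hF (MvPowerSeries.coeff_monomial_ne (fun e => hne e.symm) _)

theorem lascouxAtom_hasFormalSum (β : R) (γ : WeakComp) :
    HasFormalSum (fun F : SetSkyFill γ => fillingTerm β F.1) (lascouxAtom β γ) :=
  fun m => ⟨coeff_fillingTerm_support β _ m, rfl⟩

theorem lascouxAtom_locallyFinite (β : R) (m : ℕ →₀ ℕ) :
    (Function.support fun γ : WeakComp => MvPowerSeries.coeff m (lascouxAtom β γ)).Finite := by
  refine (Set.finite_Iic (∑ i ∈ m.support, Finsupp.single i m.degree)).subset fun γ hγ => ?_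
  obtain ⟨F, hF⟩ : ∃ F : SetSkyFill γ, MvPowerSeries.coeff m (fillingTerm β F.1) ≠ 0 := by
    by_contra! h
    exact hγ ((finsum_congr h).trans finsum_zero)
  have hm : m = F.1.content := by
    by_contra hne
    exact hF (MvPowerSeries.coeff_monomial_ne hne _)
  intro i
  rcases Nat.eq_zero_or_pos (γ i) with h0 | hpos
  · rw [h0]
    exact Nat.zero_le _
  · have hi : i ∈ m.support := hm ▸ mem_support_content F.1 (mem_firstColumn F.2 i hpos).1
    have h1 : γ i ≤ m.degree :=
      (Finsupp.le_degree i γ).trans (hm ▸ degree_le_degree_content F.1)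
    have h2 : Finsupp.single i m.degree ≤ ∑ i ∈ m.support, Finsupp.single i m.degree :=
      Finset.single_le_sum (f := fun i => Finsupp.single i m.degree) (fun _ _ => zero_le) hi
    have h3 := h2 i
    rw [Finsupp.single_eq_same] at h3
    exact h1.trans h3

/-- The quasisymmetric Grothendieck function `𝒢_α`, the sum of `𝓛_γ` over all `γ` with
`γ⁺ = α`. -/
noncomputable def quasiGrothendieck (β : R) (α : Comp) : MvPowerSeries ℕ R :=
  formalSum fun γ : {γ : WeakComp // plus γ = α.1} => lascouxAtom β γ.1

/-- The symmetric Grothendieck function `G_λ`, the generating function of set-valued reverse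
tableaux of shape `λ`. -/
noncomputable def grothendieck (β : R) (lam : Partition) : MvPowerSeries ℕ R :=
  formalSum fun T : SetRT lam.1 => fillingTerm β T.1

theorem quasiGrothendieck_hasFormalSum (β : R) (α : Comp) :
    HasFormalSum (fun γ : {γ : WeakComp // plus γ = α.1} => lascouxAtom β γ.1)
      (quasiGrothendieck β α) :=
  fun m => ⟨(lascouxAtom_locallyFinite β m).preimage Subtype.val_injective.injOn, rfl⟩

theorem grothendieck_hasFormalSum (β : R) (lam : Partition) :
    HasFormalSum (fun T : SetRT lam.1 => fillingTerm β T.1) (grothendieck β lam) :=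
  fun m => ⟨coeff_fillingTerm_support β _ m, rfl⟩

/-- Quasisymmetric power series: the coefficient of `x_{i_1}^{α_1} ⋯ x_{i_k}^{α_k}` equals that
of `x_1^{α_1} ⋯ x_k^{α_k}` for all positive `α_1, …, α_k` and all `i_1 < ⋯ < i_k`. -/
def IsQuasisymmetric (f : MvPowerSeries ℕ R) : Prop :=
  ∀ (k : ℕ) (α : Fin k → ℕ) (i : Fin k → ℕ), (∀ j, 0 < α j) → StrictMono i →
    MvPowerSeries.coeff (∑ j, Finsupp.single (i j) (α j)) f =
      MvPowerSeries.coeff (∑ j : Fin k, Finsupp.single (j : ℕ) (α j)) f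

/-- Symmetric power series: invariant under all permutations of the variables. -/
def IsSymmetric (f : MvPowerSeries ℕ R) : Prop :=
  ∀ (σ : Equiv.Perm ℕ) (m : ℕ →₀ ℕ),
    MvPowerSeries.coeff (m.mapDomain σ) f = MvPowerSeries.coeff m f

/-- `f` is `g`-positive: `f` has an expansion `∑ i, a i • g i` with all `a i` nonnegative. -/
def IsPositiveIn [PartialOrder R] {ι : Type*} (g : ι → MvPowerSeries ℕ R)
    (f : MvPowerSeries ℕ R) : Prop :=
  ∃ a : ι → R, (∀ i, 0 ≤ a i) ∧ HasFormalSum (fun i => a i • g i) f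

end Series

end Skyline

/-! The proof has a formal half and a combinatorial half.

Formally, 𝓛_γ contains x^γ with coefficient 1, and every other monomial x^m in it has larger degree
than γ, or the same degree and a smaller sum of squares of exponents. Both statistics depend only on
the multiset of nonzero parts, so they are constant on the classes given by γ⁺ or by λ(γ). Suppose f
has equal coefficients on each class, and each class contains some γ with c_γ = 0. Then c = 0:
otherwise take c_γ ≠ 0 with minimal degree and then maximal sum of squares; no other term reaches
the monomials of the class of γ, so [x^m]f = c_m there, a contradiction (`IsTriangular.eq_zero`).
Subtracting the expansion whose coefficients are replaced by those of class representatives gives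
both equivalences, provided the class sums of the 𝓛_γ are themselves class-invariant. Positivity
then follows by grouping terms by classes.

Combinatorially, three facts are needed. Triangularity: for single-valued fillings the sum of
squares of the content is the sum of |U_k ∩ U_l| over pairs of columns, where U_k is the entry set
of column k. It is largest when the U_k are nested, and then the skyline rules force row i to be
constant (`IsSemistandardSkyline.entries_eq`). Class sums: for γ⁺ = α the sum is 𝒢_α by definition.
For λ(γ) = λ it is G_λ, because skyline fillings and reverse tableaux are two ways to arrange the
same column data (sets of anchors and of entries): greedily with free entries as high as possible,
or sorted with free entries as low as possible (`skylineEquiv`). Whether a free entry fits somewhere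
in a column depends only on how many anchors exceed it there and in the next column
(`exists_fits_iff`). Invariance: strictly increasing relabellings preserve skyline fillings, so 𝒢_α
is quasisymmetric; a set-valued Bender–Knuth involution makes G_λ symmetric. -/

namespace Skyline

/-! ### Triangular families and class-invariant power series -/

section Expansions

theorem finsum_fiberwise {ι κ M : Type*} [AddCommMonoid M] (p : ι → κ) (h : ι → M)
    (hh : (Function.support h).Finite) :
    ∑ᶠ i, h i = ∑ᶠ k, ∑ᶠ i : {i // p i = k}, h i := by
  classical
  rw [finsum_eq_sum_of_support_subset h (s := hh.toFinset) (by simp)]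
  have hin : ∀ k, ∑ᶠ i : {i // p i = k}, h i = ∑ i ∈ hh.toFinset with p i = k, h i := by
    intro k
    rw [finsum_subtype_eq_finsum_cond (f := h) (fun i => p i = k)]
    refine finsum_mem_eq_sum_of_inter_support_eq (s := {i | p i = k}) h ?_
    ext i
    simp only [Set.mem_inter_iff, Set.mem_ofPred_eq, Function.mem_support, Finset.coe_filter,
      Set.Finite.mem_toFinset]
    tauto
  simp_rw [hin]
  rw [finsum_eq_sum_of_support_subset (s := hh.toFinset.image p)]
  · exact (Finset.sum_fiberwise_of_maps_to (fun i hi => Finset.mem_image_of_mem p hi) _).symm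
  · intro k hk
    obtain ⟨i, hi, -⟩ := Finset.exists_ne_zero_of_sum_ne_zero hk
    rw [Finset.mem_filter] at hi
    exact Finset.mem_coe.2 (Finset.mem_image.2 ⟨i, hi⟩)

/-- The sum of the squares of the parts. -/
def sumSq (m : WeakComp) : ℕ := m.sum fun _ a => a ^ 2

theorem sumSq_le (m : WeakComp) : sumSq m ≤ m.degree ^ 2 := by
  rw [sumSq, Finsupp.sum, Finsupp.degree_apply]
  exact Finset.sum_sq_le_sq_sum_of_nonneg fun _ _ => Nat.zero_le _

variable {R : Type*} [CommRing R]

/-- Coefficients of monomials of the same class agree. -/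
def IsClassInvariant {K : Type*} (cls : WeakComp → K) (f : MvPowerSeries ℕ R) : Prop :=
  ∀ m m', cls m = cls m' → MvPowerSeries.coeff m f = MvPowerSeries.coeff m' f

/-- A family of power series that is unitriangular for degree and then sum of squares. -/
structure IsTriangular (L : WeakComp → MvPowerSeries ℕ R) : Prop where
  finite : ∀ m, (Function.support fun γ => MvPowerSeries.coeff m (L γ)).Finite
  degree_le : ∀ m γ, MvPowerSeries.coeff m (L γ) ≠ 0 → γ.degree ≤ m.degree
  sumSq_lt : ∀ m γ, MvPowerSeries.coeff m (L γ) ≠ 0 → γ.degree = m.degree → m ≠ γ →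
    sumSq m < sumSq γ
  diag : ∀ m, MvPowerSeries.coeff m (L m) = 1

variable {L : WeakComp → MvPowerSeries ℕ R}

theorem IsTriangular.support_smul (hL : IsTriangular L) (c : WeakComp → R) (m : WeakComp) :
    (Function.support fun γ => MvPowerSeries.coeff m (c γ • L γ)).Finite :=
  (hL.finite m).subset fun γ hγ h0 => hγ (by
    simp only [MvPowerSeries.coeff_smul]
    exact mul_eq_zero_of_right _ h0)

theorem IsTriangular.hasFormalSum (hL : IsTriangular L) (c : WeakComp → R) :
    HasFormalSum (fun γ => c γ • L γ) (formalSum fun γ => c γ • L γ) :=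
  fun m => ⟨hL.support_smul c m, rfl⟩

theorem HasFormalSum.sub {ι : Type*} {g h : ι → MvPowerSeries ℕ R} {f f' : MvPowerSeries ℕ R}
    (hg : HasFormalSum g f) (hh : HasFormalSum h f') :
    HasFormalSum (fun i => g i - h i) (f - f') := by
  intro m
  have := finsum_sub_distrib (hg m).1 (hh m).1
  refine ⟨((hg m).1.union (hh m).1).subset fun i hi => ?_, ?_⟩
  · by_contra hc
    simp only [Set.mem_union, Function.mem_support, not_or, not_not] at hc
    exact hi (by simp [hc.1, hc.2])
  · simp only [map_sub]
    rw [this, (hg m).2, (hh m).2]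

/-- An extremal nonzero coefficient can be read off from f on its whole class, because triangularity
keeps all other terms away from these monomials; the vanishing coefficient in the class then
contradicts invariance. -/
theorem IsTriangular.eq_zero (hL : IsTriangular L) {K : Type*} {cls : WeakComp → K}
    (hdeg : ∀ γ δ, cls γ = cls δ → γ.degree = δ.degree)
    (hsq : ∀ γ δ, cls γ = cls δ → sumSq γ = sumSq δ)
    {c : WeakComp → R} {f : MvPowerSeries ℕ R} (hf : HasFormalSum (fun γ => c γ • L γ) f)
    (hinv : IsClassInvariant cls f) (h0 : ∀ γ, ∃ δ, cls δ = cls γ ∧ c δ = 0) :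
    ∀ γ, c γ = 0 := by
  by_contra! hne
  obtain ⟨γ₁, hγ₁, hmin⟩ := WellFounded.has_min
    (InvImage.wf (fun γ : WeakComp => γ.degree) Nat.lt_wfRel.wf) {γ | c γ ≠ 0} hne
  -- Within the minimal degree the sum of squares is maximised. It is at most the squared degree, so
  -- the truncated difference reverses the order faithfully.
  obtain ⟨γ₂, ⟨hγ₂, hd₂⟩, hmax⟩ := WellFounded.has_min
    (InvImage.wf (fun γ : WeakComp => γ₁.degree ^ 2 - sumSq γ) Nat.lt_wfRel.wf)
    {γ | c γ ≠ 0 ∧ γ.degree = γ₁.degree} ⟨γ₁, hγ₁, rfl⟩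
  have key : ∀ m : WeakComp, m.degree = γ₂.degree → sumSq m = sumSq γ₂ →
      MvPowerSeries.coeff m f = c m := by
    intro m hmd hms
    rw [(hf m).2, finsum_eq_single _ m]
    · simp [hL.diag]
    · intro δ hδ
      by_contra hne0
      rw [MvPowerSeries.coeff_smul] at hne0
      have hcδ : c δ ≠ 0 := fun h => hne0 (by rw [h, zero_mul])
      have hco : MvPowerSeries.coeff m (L δ) ≠ 0 := fun h => hne0 (by rw [h, mul_zero])
      have h1 := hL.degree_le m δ hco
      have h2 : ¬ δ.degree < γ₁.degree := hmin δ hcδ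
      have h3 := hL.sumSq_lt m δ hco (by omega) hδ.symm
      have h4 : ¬ γ₁.degree ^ 2 - sumSq δ < γ₁.degree ^ 2 - sumSq γ₂ :=
        hmax δ ⟨hcδ, by omega⟩
      have h5 := sumSq_le δ
      have h6 : δ.degree = γ₁.degree := by omega
      rw [h6] at h5
      omega
  obtain ⟨δ, hδ, hcδ⟩ := h0 γ₂
  apply hγ₂
  rw [← key γ₂ rfl rfl, ← hinv δ γ₂ hδ, key δ (hdeg _ _ hδ) (hsq _ _ hδ), hcδ]

/-- Grouping an expansion with class-constant coefficients by classes. -/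
theorem IsTriangular.coeff_eq_finsum_class (hL : IsTriangular L) {K : Type*} {cls : WeakComp → K}
    {G : K → MvPowerSeries ℕ R}
    (hG : ∀ k m, MvPowerSeries.coeff m (G k) =
      ∑ᶠ γ : {γ // cls γ = k}, MvPowerSeries.coeff m (L γ.1))
    (b : K → R) (m : WeakComp) :
    ∑ᶠ γ, MvPowerSeries.coeff m (b (cls γ) • L γ) = ∑ᶠ k, MvPowerSeries.coeff m (b k • G k) := by
  rw [finsum_fiberwise cls _ (hL.support_smul (fun γ => b (cls γ)) m)]
  refine finsum_congr fun k => ?_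
  rw [MvPowerSeries.coeff_smul, hG, mul_finsum']
  · exact finsum_congr fun γ => by rw [MvPowerSeries.coeff_smul, γ.2]
  · exact (hL.finite m).preimage Subtype.val_injective.injOn

theorem IsTriangular.support_class (hL : IsTriangular L) {K : Type*} {cls : WeakComp → K}
    {G : K → MvPowerSeries ℕ R}
    (hG : ∀ k m, MvPowerSeries.coeff m (G k) =
      ∑ᶠ γ : {γ // cls γ = k}, MvPowerSeries.coeff m (L γ.1))
    (b : K → R) (m : WeakComp) :
    (Function.support fun k => MvPowerSeries.coeff m (b k • G k)).Finite := by
  refine ((hL.finite m).image cls).subset fun k hk => ?_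
  by_contra hc
  apply hk
  simp only [MvPowerSeries.coeff_smul]
  rw [hG]
  refine mul_eq_zero_of_right _ (finsum_eq_zero_of_forall_eq_zero fun γ => ?_)
  by_contra hne
  exact hc ⟨γ.1, hne, γ.2⟩

theorem IsTriangular.invariant_of_const (hL : IsTriangular L) {K : Type*} {cls : WeakComp → K}
    {G : K → MvPowerSeries ℕ R}
    (hG : ∀ k m, MvPowerSeries.coeff m (G k) =
      ∑ᶠ γ : {γ // cls γ = k}, MvPowerSeries.coeff m (L γ.1))
    (hinv : ∀ k, IsClassInvariant cls (G k)) (b : K → R) {f : MvPowerSeries ℕ R}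
    (hf : HasFormalSum (fun γ => b (cls γ) • L γ) f) : IsClassInvariant cls f := by
  intro m m' hm
  rw [(hf m).2, (hf m').2, hL.coeff_eq_finsum_class hG, hL.coeff_eq_finsum_class hG]
  refine finsum_congr fun k => ?_
  rw [MvPowerSeries.coeff_smul, MvPowerSeries.coeff_smul, hinv k m m' hm]

/-- For the forward direction, the series whose coefficients are copied from class representatives
is invariant; its difference with f has coefficient zero at each representative, so
`IsTriangular.eq_zero` applies. -/
theorem IsTriangular.invariant_iff (hL : IsTriangular L) {K : Type*} {cls : WeakComp → K}
    (hdeg : ∀ γ δ, cls γ = cls δ → γ.degree = δ.degree)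
    (hsq : ∀ γ δ, cls γ = cls δ → sumSq γ = sumSq δ)
    {G : K → MvPowerSeries ℕ R}
    (hG : ∀ k m, MvPowerSeries.coeff m (G k) =
      ∑ᶠ γ : {γ // cls γ = k}, MvPowerSeries.coeff m (L γ.1))
    (hinv : ∀ k, IsClassInvariant cls (G k)) {c : WeakComp → R} {f : MvPowerSeries ℕ R}
    (hf : HasFormalSum (fun γ => c γ • L γ) f) :
    IsClassInvariant cls f ↔ ∀ γ δ, cls γ = cls δ → c γ = c δ := by
  have hrep : ∀ γ, cls (Function.invFun cls (cls γ)) = cls γ :=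
    fun γ => Function.invFun_eq ⟨γ, rfl⟩
  constructor
  · intro hfi
    have hg := hL.hasFormalSum fun γ => c (Function.invFun cls (cls γ))
    have hgi := hL.invariant_of_const hG hinv (fun k => c (Function.invFun cls k)) hg
    have hsub := hf.sub hg
    simp only [← sub_smul] at hsub
    have h0 := hL.eq_zero hdeg hsq hsub
      (fun m m' hm => by rw [map_sub, map_sub, hfi m m' hm, hgi m m' hm])
      (fun γ => ⟨Function.invFun cls (cls γ), hrep γ, by rw [hrep, sub_self]⟩)
    intro γ δ h
    rw [sub_eq_zero.1 (h0 γ), sub_eq_zero.1 (h0 δ), h]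
  · intro hc
    refine hL.invariant_of_const hG hinv (fun k => c (Function.invFun cls k)) ?_
    simpa only [hc _ _ (hrep _)] using hf

theorem IsTriangular.positive_iff [PartialOrder R] (hL : IsTriangular L) {K : Type*}
    {cls : WeakComp → K}
    (hdeg : ∀ γ δ, cls γ = cls δ → γ.degree = δ.degree)
    (hsq : ∀ γ δ, cls γ = cls δ → sumSq γ = sumSq δ)
    {G : K → MvPowerSeries ℕ R}
    (hG : ∀ k m, MvPowerSeries.coeff m (G k) =
      ∑ᶠ γ : {γ // cls γ = k}, MvPowerSeries.coeff m (L γ.1))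
    (hinv : ∀ k, IsClassInvariant cls (G k)) {f : MvPowerSeries ℕ R}
    (hfi : IsClassInvariant cls f) :
    IsPositiveIn G f ↔ IsPositiveIn L f := by
  constructor
  · rintro ⟨b, hb, hf⟩
    exact ⟨fun γ => b (cls γ), fun γ => hb _, fun m => ⟨hL.support_smul _ m, by
      rw [(hf m).2, hL.coeff_eq_finsum_class hG]⟩⟩
  · rintro ⟨a, ha, hf⟩
    have hc := (hL.invariant_iff hdeg hsq hG hinv hf).1 hfi
    -- A class without members gets an arbitrary nonnegative coefficient; its `G k` is an empty sum.
    refine ⟨fun k => a (Function.invFun cls k), fun k => ha _, fun m =>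
      ⟨hL.support_class hG _ m, ?_⟩⟩
    rw [(hf m).2, ← hL.coeff_eq_finsum_class hG]
    exact finsum_congr fun γ => by rw [hc _ γ (Function.invFun_eq ⟨γ, rfl⟩)]

end Expansions

/-! ### Multisets of parts, partitions and the two symmetry conditions -/

section Classes

/-- The multiset of nonzero parts of a weak composition. -/
def parts (γ : WeakComp) : Multiset ℕ := γ.support.val.map γ

theorem zero_notMem_parts (γ : WeakComp) : 0 ∉ parts γ := by
  simp only [parts, Multiset.mem_map, Finset.mem_val, Finsupp.mem_support_iff, not_exists,
    not_and]
  exact fun i h => h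

theorem coe_plus (γ : WeakComp) : (plus γ : Multiset ℕ) = parts γ := by
  rw [plus, ← Multiset.map_coe, Finset.sort_eq, parts]

theorem degree_eq_sum_parts (γ : WeakComp) : γ.degree = (parts γ).sum := by
  rw [Finsupp.degree_apply, Finset.sum, parts]

theorem sumSq_eq_sum_parts (γ : WeakComp) : sumSq γ = ((parts γ).map (· ^ 2)).sum := by
  rw [sumSq, Finsupp.sum, Finset.sum, parts, Multiset.map_map]
  rfl

/-- Passing to a finitely supported function only forgets trailing zeros. -/
theorem toFinsupp_injective {l l' : List ℕ} (hl : 0 ∉ l) (hl' : 0 ∉ l')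
    (h : l.toFinsupp = l'.toFinsupp) : l = l' := by
  have hget : ∀ n, l.getD n 0 = l'.getD n 0 := fun n => DFunLike.congr_fun h n
  have aux : ∀ {l l' : List ℕ}, 0 ∉ l' → (∀ n, l.getD n 0 = l'.getD n 0) →
      l'.length ≤ l.length := by
    intro l l' hl' hget
    by_contra! hlt
    have := hget l.length
    rw [List.getD_eq_default _ _ le_rfl, List.getD_eq_getElem _ _ hlt] at this
    exact hl' (this ▸ List.getElem_mem hlt)
  refine List.ext_getElem (le_antisymm (aux hl fun n => (hget n).symm) (aux hl' hget)) ?_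
  intro n h1 h2
  have := hget n
  rwa [List.getD_eq_getElem _ _ h1, List.getD_eq_getElem _ _ h2] at this

theorem parts_eq_of_partitionOf_eq {γ δ : WeakComp} (h : partitionOf γ = partitionOf δ) :
    parts γ = parts δ := by
  have h1 : sortParts γ = sortParts δ := congrArg Subtype.val h
  have h2 : (parts γ).sort (· ≥ ·) = (parts δ).sort (· ≥ ·) :=
    toFinsupp_injective (by simpa using zero_notMem_parts γ) (by simpa using zero_notMem_parts δ) h1
  rw [← Multiset.sort_eq (parts γ) (· ≥ ·), h2, Multiset.sort_eq]

theorem partitionOf_eq_of_parts_eq {γ δ : WeakComp} (h : parts γ = parts δ) :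
    partitionOf γ = partitionOf δ := by
  refine Subtype.ext ?_
  change ((parts γ).sort (· ≥ ·)).toFinsupp = ((parts δ).sort (· ≥ ·)).toFinsupp
  simp only [h]

theorem parts_mapDomain {φ : ℕ → ℕ} (hφ : Function.Injective φ) (γ : WeakComp) :
    parts (γ.mapDomain φ) = parts γ := by
  have : (γ.mapDomain φ).support = γ.support.map ⟨φ, hφ⟩ := by
    rw [Finsupp.mapDomain_support_of_injective hφ, Finset.map_eq_image]
    rfl
  rw [parts, this, Finset.map_val, Multiset.map_map, parts]
  refine Multiset.map_congr rfl fun x _ => ?_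
  exact Finsupp.mapDomain_apply hφ γ x

/-- The number of parts greater than `k`: the length of column `k` of the diagram. -/
def colLength (γ : WeakComp) (k : ℕ) : ℕ := (γ.support.filter (k < γ ·)).card

/-- The number of parts equal to k + 1 is the difference of the lengths of columns k and k + 1. -/
theorem parts_eq_of_colLength_eq {γ δ : WeakComp} (h : ∀ k, colLength γ k = colLength δ k) :
    parts γ = parts δ := by
  have key : ∀ (γ : WeakComp) (k : ℕ),
      (parts γ).count (k + 1) + colLength γ (k + 1) = colLength γ k := by
    intro γ k
    have h1 : (parts γ).count (k + 1) = (γ.support.filter (k + 1 = γ ·)).card := by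
      rw [parts, Multiset.count_map]
      rfl
    rw [h1, colLength, colLength, ← Finset.card_union_of_disjoint]
    · congr 1
      ext i
      simp only [Finset.mem_union, Finset.mem_filter]
      constructor
      · rintro (⟨hi, h⟩ | ⟨hi, h⟩) <;> exact ⟨hi, by omega⟩
      · rintro ⟨hi, h⟩
        rcases (Nat.succ_le_of_lt h).eq_or_lt with h' | h'
        · exact Or.inl ⟨hi, h'⟩
        · exact Or.inr ⟨hi, h'⟩
    · rw [Finset.disjoint_filter]
      intro i _ h
      omega
  ext a
  rcases a with _ | k
  · rw [Multiset.count_eq_zero_of_notMem (zero_notMem_parts γ),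
      Multiset.count_eq_zero_of_notMem (zero_notMem_parts δ)]
  · have h1 := key γ k
    have h2 := key δ k
    rw [h, h] at h1
    omega

theorem partitionOf_coe (lam : Partition) : partitionOf lam.1 = lam := by
  obtain ⟨lam, hlam⟩ := lam
  refine Subtype.ext ?_
  -- The support of a weakly decreasing sequence is an initial segment.
  have hs : lam.support = Finset.range lam.support.card := by
    refine Finset.eq_of_subset_of_card_le (fun i hi => ?_) (by simp)
    rw [Finset.mem_range]
    have : Finset.range (i + 1) ⊆ lam.support := fun j hj => by
      rw [Finset.mem_range] at hj
      have := hlam (show j ≤ i by omega)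
      rw [Finsupp.mem_support_iff] at hi ⊢
      omega
    simpa using Finset.card_le_card this
  generalize hn : lam.support.card = n at hs
  have hsort : (parts lam).sort (· ≥ ·) = (List.range n).map lam := by
    have hp : ((List.range n).map lam).Pairwise (· ≥ ·) := by
      rw [List.pairwise_map]
      exact List.pairwise_lt_range.imp fun h => hlam h.le
    have : parts lam = (((List.range n).map lam : List ℕ) : Multiset ℕ) := by
      rw [parts, hs, Finset.range_val, Multiset.range, Multiset.map_coe]
    rw [this, Multiset.coe_sort]
    exact List.mergeSort_eq_self _ (hp.imp (by simp))
  change ((parts lam).sort (· ≥ ·)).toFinsupp = lam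
  simp only [hsort]
  ext i
  rw [List.toFinsupp_apply]
  by_cases hi : i < n
  · rw [List.getD_eq_getElem _ _ (by simpa using hi)]
    simp
  · rw [List.getD_eq_default _ _ (by simpa using hi)]
    have : i ∉ lam.support := by rw [hs]; simpa using hi
    exact (Finsupp.notMem_support_iff.1 this).symm

theorem partitionOf_eq_of_colLength_eq {γ : WeakComp} {lam : Partition}
    (h : ∀ k, colLength γ k = colLength lam.1 k) : partitionOf γ = lam := by
  rw [← partitionOf_coe lam]
  exact partitionOf_eq_of_parts_eq (parts_eq_of_colLength_eq h)

/-- The group generated by the adjacent transpositions. -/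
def adjacentSwaps : Subgroup (Equiv.Perm ℕ) :=
  Subgroup.closure (Set.range fun i => Equiv.swap i (i + 1))

theorem swap_mem_adjacentSwaps (x y : ℕ) : Equiv.swap x y ∈ adjacentSwaps := by
  wlog hxy : x < y generalizing x y
  · rcases (not_lt.1 hxy).eq_or_lt with rfl | h
    · rw [Equiv.swap_self]
      exact Subgroup.one_mem _
    · rw [Equiv.swap_comm]
      exact this y x h
  have hadj : ∀ i, Equiv.swap i (i + 1) ∈ adjacentSwaps :=
    fun i => Subgroup.subset_closure ⟨i, rfl⟩
  induction y, hxy using Nat.le_induction with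
  | base => exact hadj x
  | succ n hn ih =>
    -- Conjugating the swap of x and n by the swap of n and n + 1 gives the swap of x and n + 1.
    have := Equiv.swap_mul_swap_mul_swap (x := x) (y := n) (z := n + 1) (by omega) (by omega)
    rw [Equiv.swap_comm x (n + 1), ← this]
    exact Subgroup.mul_mem _ (Subgroup.mul_mem _ (hadj n) ih) (hadj n)

/-- An arbitrary permutation of ℕ need not be a finite product of adjacent swaps, but on the finite
support of a monomial it agrees with one. Values are corrected one at a time, and injectivity keeps
the earlier ones fixed. -/
theorem exists_adjacentSwaps_eqOn (s : Finset ℕ) (g : ℕ → ℕ) (hg : Set.InjOn g s) :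
    ∃ τ ∈ adjacentSwaps, ∀ x ∈ s, τ x = g x := by
  induction s using Finset.induction_on with
  | empty => exact ⟨1, Subgroup.one_mem _, by simp⟩
  | insert x s hx ih =>
    obtain ⟨τ, hτ, h⟩ := ih (hg.mono (by simp))
    refine ⟨Equiv.swap (τ x) (g x) * τ, Subgroup.mul_mem _ (swap_mem_adjacentSwaps _ _) hτ, ?_⟩
    intro y hy
    rw [Equiv.Perm.mul_apply]
    rcases Finset.mem_insert.1 hy with rfl | hys
    · exact Equiv.swap_apply_left _ _
    · have hne : y ≠ x := fun h => hx (h ▸ hys)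
      rw [Equiv.swap_apply_of_ne_of_ne (τ.injective.ne hne), h y hys]
      rw [h y hys]
      exact hg.ne (Finset.mem_coe.2 hy) (by simp) hne

theorem exists_adjacentSwaps_mapDomain {γ δ : WeakComp} (h : parts γ = parts δ) :
    ∃ τ ∈ adjacentSwaps, γ.mapDomain τ = δ := by
  have hcard : ∀ v, (γ.support.filter (v = γ ·)).card = (δ.support.filter (v = δ ·)).card := by
    intro v
    have := congrArg (Multiset.count v) h
    rw [parts, parts, Multiset.count_map, Multiset.count_map] at this
    exact this
  -- The positions of each value v are matched separately; the matchings are then glued into one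
  -- injection on the support.
  have hbij : ∀ v, ∃ e : ℕ → ℕ, Set.BijOn e (γ.support.filter (v = γ ·) : Finset ℕ)
      (δ.support.filter (v = δ ·) : Finset ℕ) := fun v =>
    (Finset.finite_toSet _).exists_bijOn_of_encard_eq (by
      rw [Set.encard_coe_eq_coe_finsetCard, Set.encard_coe_eq_coe_finsetCard, hcard])
  choose e he using hbij
  have hmem : ∀ i ∈ γ.support, e (γ i) i ∈ δ.support ∧ γ i = δ (e (γ i) i) := by
    intro i hi
    have := (he (γ i)).mapsTo (Finset.mem_coe.2 (Finset.mem_filter.2 ⟨hi, rfl⟩))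
    exact Finset.mem_filter.1 (Finset.mem_coe.1 this)
  have hinj : Set.InjOn (fun i => e (γ i) i) γ.support := by
    intro i hi j hj hij
    have hv : γ i = γ j := by
      rw [(hmem i hi).2, (hmem j hj).2]
      exact congrArg δ hij
    refine (he (γ i)).injOn (Finset.mem_coe.2 (Finset.mem_filter.2 ⟨hi, rfl⟩))
      (Finset.mem_coe.2 (Finset.mem_filter.2 ⟨hj, hv⟩)) ?_
    simpa only [hv] using hij
  obtain ⟨τ, hτ, hτe⟩ := exists_adjacentSwaps_eqOn γ.support _ hinj
  refine ⟨τ, hτ, ?_⟩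
  have himage : γ.support.image (fun i => e (γ i) i) = δ.support := by
    refine Finset.eq_of_subset_of_card_le (fun y hy => ?_) ?_
    · obtain ⟨i, hi, rfl⟩ := Finset.mem_image.1 hy
      exact (hmem i hi).1
    · rw [Finset.card_image_of_injOn hinj]
      have := congrArg Multiset.card h
      rw [parts, parts, Multiset.card_map, Multiset.card_map] at this
      exact this.ge
  ext y
  obtain ⟨x, rfl⟩ := τ.surjective y
  rw [Finsupp.mapDomain_apply τ.injective]
  by_cases hx : x ∈ γ.support
  · rw [hτe x hx]
    exact (hmem x hx).2
  · rw [Finsupp.notMem_support_iff.1 hx]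
    by_contra hne
    have : τ x ∈ δ.support := Finsupp.mem_support_iff.2 (Ne.symm hne)
    rw [← himage] at this
    obtain ⟨i, hi, hi'⟩ := Finset.mem_image.1 this
    rw [← hτe i hi] at hi'
    exact hx (τ.injective hi' ▸ hi)

variable {R : Type*} [CommRing R]

/-- Monomials of equal partition differ by a finite product of adjacent swaps, so only adjacent
swaps need checking; these are what Bender–Knuth involutions supply. -/
theorem isClassInvariant_partitionOf {f : MvPowerSeries ℕ R}
    (hf : ∀ (i : ℕ) (m : WeakComp), MvPowerSeries.coeff (m.mapDomain (Equiv.swap i (i + 1))) f =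
      MvPowerSeries.coeff m f) :
    IsClassInvariant partitionOf f := by
  have key : ∀ τ ∈ adjacentSwaps, ∀ m : WeakComp,
      MvPowerSeries.coeff (m.mapDomain τ) f = MvPowerSeries.coeff m f := by
    intro τ hτ
    induction hτ using Subgroup.closure_induction with
    | mem τ h =>
      obtain ⟨i, rfl⟩ := h
      exact hf i
    | one => intro m; rw [Equiv.Perm.coe_one, Finsupp.mapDomain_id]
    | mul τ τ' _ _ h h' =>
      intro m
      rw [Equiv.Perm.coe_mul, Finsupp.mapDomain_comp, h, h']
    | inv τ _ h =>
      intro m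
      rw [← h, ← Finsupp.mapDomain_comp, ← Equiv.Perm.coe_mul, mul_inv_cancel,
        Equiv.Perm.coe_one, Finsupp.mapDomain_id]
  intro m m' h
  obtain ⟨τ, hτ, rfl⟩ := exists_adjacentSwaps_mapDomain (parts_eq_of_partitionOf_eq h)
  exact (key τ hτ m).symm

theorem isSymmetric_iff {f : MvPowerSeries ℕ R} :
    IsSymmetric f ↔ IsClassInvariant partitionOf f :=
  ⟨fun hf => isClassInvariant_partitionOf fun _ m => hf _ m, fun hf σ m =>
    hf _ _ (partitionOf_eq_of_parts_eq (parts_mapDomain σ.injective m))⟩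

theorem parts_eq_of_plus_eq {γ δ : WeakComp} (h : plus γ = plus δ) : parts γ = parts δ := by
  rw [← coe_plus, h, coe_plus]

theorem plus_sum_single {k : ℕ} {α i : Fin k → ℕ} (hα : ∀ j, 0 < α j) (hi : StrictMono i) :
    plus (∑ j, Finsupp.single (i j) (α j)) = List.ofFn α := by
  have happ : ∀ j, (∑ j, Finsupp.single (i j) (α j) : WeakComp) (i j) = α j := by
    intro j
    rw [Finsupp.finsetSum_apply, Finset.sum_eq_single j]
    · simp
    · intro j' _ hj'
      exact Finsupp.single_eq_of_ne (hi.injective.ne hj'.symm)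
    · simp
  have hsupp : (∑ j, Finsupp.single (i j) (α j) : WeakComp).support = (List.ofFn i).toFinset := by
    ext x
    rw [List.mem_toFinset, List.mem_ofFn, Finsupp.mem_support_iff]
    constructor
    · intro hx
      rw [Finsupp.finsetSum_apply] at hx
      obtain ⟨j, -, hj⟩ := Finset.exists_ne_zero_of_sum_ne_zero hx
      exact ⟨j, by_contra fun h => hj (Finsupp.single_eq_of_ne (Ne.symm h))⟩
    · rintro ⟨j, rfl⟩
      rw [happ]
      exact (hα j).ne'
  have hpair : (List.ofFn i).Pairwise (· < ·) := List.pairwise_ofFn.2 fun a b h => hi h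
  rw [plus, hsupp, (List.toFinset_sort (· ≤ ·) (hpair.imp fun h => h.ne)).2
    (hpair.imp fun h => h.le), List.map_ofFn]
  exact congrArg List.ofFn (funext happ)

theorem exists_eq_sum_single (m : WeakComp) : ∃ (k : ℕ) (α i : Fin k → ℕ), (∀ j, 0 < α j) ∧
    StrictMono i ∧ m = ∑ j, Finsupp.single (i j) (α j) := by
  refine ⟨_, fun j => m (m.support.orderEmbOfFin rfl j), m.support.orderEmbOfFin rfl,
    fun j => ?_, (m.support.orderEmbOfFin rfl).strictMono, ?_⟩
  · exact Nat.pos_of_ne_zero (Finsupp.mem_support_iff.1 (Finset.orderEmbOfFin_mem _ rfl j))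
  · conv_lhs => rw [← Finsupp.sum_single m]
    rw [Finsupp.sum]
    refine (Finset.sum_nbij (m.support.orderEmbOfFin rfl)
      (fun j _ => Finset.orderEmbOfFin_mem _ rfl j)
      (m.support.orderEmbOfFin rfl).injective.injOn ?_ fun _ _ => rfl).symm
    intro x hx
    rw [← Finset.range_orderEmbOfFin m.support rfl] at hx
    simpa using hx

theorem isQuasisymmetric_iff {f : MvPowerSeries ℕ R} :
    IsQuasisymmetric f ↔ IsClassInvariant plus f := by
  constructor
  · intro hf m m' h
    obtain ⟨k, α, i, hα, hi, rfl⟩ := exists_eq_sum_single m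
    obtain ⟨k', α', i', hα', hi', rfl⟩ := exists_eq_sum_single m'
    rw [plus_sum_single hα hi, plus_sum_single hα' hi'] at h
    obtain rfl : k = k' := by simpa using congrArg List.length h
    obtain rfl := List.ofFn_injective h
    rw [hf k α i hα hi, hf k α i' hα' hi']
  · intro hf k α i hα hi
    refine hf _ _ ?_
    rw [plus_sum_single hα hi, plus_sum_single hα Fin.val_strictMono]

theorem exists_strictMono_extension {k : ℕ} {i : Fin k → ℕ} (hi : StrictMono i) :
    ∃ φ : ℕ → ℕ, StrictMono φ ∧ ∀ j : Fin k, φ j = i j := by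
  -- Beyond k, shifting by the supremum of i stays above all earlier values.
  refine ⟨fun n => if h : n < k then i ⟨n, h⟩ else n + Finset.univ.sup i,
    strictMono_nat_of_lt_succ fun n => ?_, fun j => by simp⟩
  by_cases h : n + 1 < k
  · rw [dif_pos h, dif_pos (by omega)]
    exact hi (Fin.mk_lt_mk.2 (by omega))
  · rw [dif_neg h]
    split_ifs with h'
    · have := Finset.le_sup (f := i) (Finset.mem_univ ⟨n, h'⟩)
      omega
    · omega

theorem plus_mapDomain {φ : ℕ → ℕ} (hφ : StrictMono φ) (γ : WeakComp) :
    plus (γ.mapDomain φ) = plus γ := by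
  obtain ⟨k, α, i, hα, hi, rfl⟩ := exists_eq_sum_single γ
  rw [Finsupp.mapDomain_finsetSum]
  simp only [Finsupp.mapDomain_single]
  rw [plus_sum_single hα hi, plus_sum_single (i := fun j => φ (i j)) hα (hφ.comp hi)]

/-- An increasing choice of variables extends to a strictly increasing map of all indices, so
quasisymmetry reduces to invariance under such relabellings. -/
theorem isClassInvariant_plus {f : MvPowerSeries ℕ R}
    (hf : ∀ φ : ℕ → ℕ, StrictMono φ → ∀ m : WeakComp,
      MvPowerSeries.coeff (m.mapDomain φ) f = MvPowerSeries.coeff m f) :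
    IsClassInvariant plus f := by
  rw [← isQuasisymmetric_iff]
  intro k α i hα hi
  obtain ⟨φ, hφ, hφi⟩ := exists_strictMono_extension hi
  rw [← hf φ hφ (∑ j : Fin k, Finsupp.single (j : ℕ) (α j)), Finsupp.mapDomain_finsetSum]
  simp only [Finsupp.mapDomain_single, hφi]

end Classes

/-! ### Skyline fillings as greedy anchor arrays with free entries placed highest -/

section Regular

variable {γ δ : WeakComp}

/-- The anchor of a box plus one; `0` outside the diagram. -/
def anch (F : SetFilling γ) (i k : ℕ) : ℕ := (F.entries i k).sup Nat.succ

theorem succ_le_anch {F : SetFilling γ} {i k x : ℕ} (hx : x ∈ F.entries i k) :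
    x + 1 ≤ anch F i k :=
  Finset.le_sup (f := Nat.succ) hx

theorem exists_mem_of_anch_pos {F : SetFilling γ} {i k : ℕ} (h : 0 < anch F i k) :
    ∃ x ∈ F.entries i k, x + 1 = anch F i k := by
  have hne : (F.entries i k).Nonempty := by
    rw [Finset.nonempty_iff_ne_empty]
    intro h0
    rw [anch, h0] at h
    exact absurd h (by simp)
  obtain ⟨x, hx, hxa⟩ := Finset.exists_mem_eq_sup _ hne Nat.succ
  exact ⟨x, hx, hxa.symm⟩

theorem anch_pos_iff {F : SetFilling γ} {i k : ℕ} : 0 < anch F i k ↔ k < γ i := by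
  rw [← F.nonempty_iff]
  constructor
  · intro h
    obtain ⟨x, hx, -⟩ := exists_mem_of_anch_pos h
    exact ⟨x, hx⟩
  · rintro ⟨x, hx⟩
    exact lt_of_lt_of_le (Nat.succ_pos x) (succ_le_anch hx)

theorem mem_of_anch_eq {F : SetFilling γ} {i k x : ℕ} (h : anch F i k = x + 1) :
    x ∈ F.entries i k := by
  obtain ⟨y, hy, hya⟩ := exists_mem_of_anch_pos (F := F) (i := i) (k := k) (by omega)
  obtain rfl : y = x := by omega
  exact hy

theorem anchor_add_one {F : SetFilling γ} {i k : ℕ} (h : k < γ i) :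
    F.anchor i (k + 1) + 1 = anch F i k := by
  obtain ⟨x, hx, hxa⟩ := exists_mem_of_anch_pos (anch_pos_iff.2 h)
  have h1 : x ≤ F.anchor i (k + 1) := Finset.le_sup (f := id) hx
  have h2 : F.anchor i (k + 1) ≤ x := Finset.sup_le fun y hy => by
    have := succ_le_anch (F := F) (i := i) (k := k) hy
    simp only [id]
    omega
  omega

theorem anchor_zero (F : SetFilling γ) (i : ℕ) : F.anchor i 0 = i := by
  simp [SetFilling.anchor, SetFilling.box]

/-- A free entry `x` fits into box `(i, k)` of a filling with anchor array `a`. -/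
def Fits (a : ℕ → ℕ → ℕ) (i k x : ℕ) : Prop := a i (k + 1) ≤ x + 1 ∧ x + 1 < a i k

/-- Fillings with weakly decreasing rows, without repetitions in columns, in which each free entry
is in the first row with respect to `r` into which it fits. -/
structure IsRegular (r : ℕ → ℕ → Prop) (F : SetFilling γ) : Prop where
  row : ∀ i k, ∀ x ∈ F.entries i k, ∀ y ∈ F.entries i (k + 1), y ≤ x
  col : ∀ i j k x, x ∈ F.entries i k → x ∈ F.entries j k → i = j
  ext : ∀ i k, ∀ x ∈ F.entries i k, x + 1 < anch F i k → ∀ i', r i' i → ¬ Fits (anch F) i' k x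

variable {r : ℕ → ℕ → Prop}

theorem IsRegular.anch_succ_le_succ {F : SetFilling γ} (hF : IsRegular r F) {i k x : ℕ}
    (hx : x ∈ F.entries i k) : anch F i (k + 1) ≤ x + 1 :=
  Finset.sup_le fun y hy => Nat.succ_le_succ (hF.row i k x hx y hy)

theorem IsRegular.fits {F : SetFilling γ} (hF : IsRegular r F) {i k x : ℕ}
    (hx : x ∈ F.entries i k) (h : x + 1 < anch F i k) : Fits (anch F) i k x :=
  ⟨hF.anch_succ_le_succ hx, h⟩

theorem IsRegular.anch_succ_le {F : SetFilling γ} (hF : IsRegular r F) (i k : ℕ) :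
    anch F i (k + 1) ≤ anch F i k := by
  rcases Nat.eq_zero_or_pos (anch F i (k + 1)) with h | h
  · omega
  · have := anch_pos_iff.1 h
    obtain ⟨x, hx, hxa⟩ := exists_mem_of_anch_pos (F := F) (i := i) (k := k)
      (anch_pos_iff.2 (by omega))
    exact hxa ▸ hF.anch_succ_le_succ hx

theorem IsRegular.anch_inj {F : SetFilling γ} (hF : IsRegular r F) {i j k : ℕ}
    (h : anch F i k = anch F j k) (hpos : 0 < anch F i k) : i = j := by
  obtain ⟨x, hx, hxa⟩ := exists_mem_of_anch_pos hpos
  exact hF.col i j k x hx (mem_of_anch_eq (by omega))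

/-- The anchors of each column are placed into the highest possible rows, in decreasing order. -/
def IsGreedy (a : ℕ → ℕ → ℕ) : Prop :=
  ∀ k i j, i < j → 0 < a j (k + 1) → a i k < a j (k + 1) ∨ a j (k + 1) < a i (k + 1)

theorem IsSemistandardSkyline.isRegular {F : SetFilling γ} (hF : IsSemistandardSkyline F) :
    IsRegular (· < ·) F where
  row i k := hF.row i (k + 1)
  col i j k x hi hj := by
    by_contra hne
    exact Finset.disjoint_left.1 (hF.column i j (k + 1) hne) hi hj
  ext i k x hx hxa i' hi' hfit := by
    have hk : k < γ i := (F.nonempty_iff i k).1 ⟨x, hx⟩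
    have hk' : k < γ i' := anch_pos_iff.1 (Nat.zero_lt_of_lt hfit.2)
    have h1 := anchor_add_one (F := F) hk
    have h2 := anchor_add_one (F := F) hk'
    have h3 := hfit.2
    refine hF.free i k x hx (by omega) i' hi' ⟨hk', by omega, fun y hy => ?_, fun y hy => ?_⟩
    -- The condition on the left neighbour is automatic: its entries are at least the anchor of the
    -- box, which exceeds x.
    · obtain ⟨z, hz, hza⟩ := exists_mem_of_anch_pos (anch_pos_iff.2 hk')
      have := hF.row i' k y hy z hz
      omega
    · have := succ_le_anch (F := F) (i := i') (k := k + 1) hy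
      have := hfit.1
      omega

theorem IsSemistandardSkyline.anch_zero {F : SetFilling γ} (hF : IsSemistandardSkyline F)
    {i : ℕ} (hi : 0 < anch F i 0) : anch F i 0 = i + 1 := by
  have h := anch_pos_iff.1 hi
  rw [← anchor_add_one h, (mem_firstColumn hF i h).2]

/-- A type A triple is exactly the greedy alternative. If the upper row is shorter, the type B
triples give the first alternative in every column, by propagation from the basement. -/
theorem IsSemistandardSkyline.isGreedy {F : SetFilling γ} (hF : IsSemistandardSkyline F) :
    IsGreedy (anch F) := by
  have hanti := hF.isRegular.anch_succ_le
  have hanchor : ∀ i k, k < γ i → F.anchor i (k + 1) ≤ F.anchor i k := by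
    rintro i (_ | k) h
    · rw [anchor_zero, (mem_firstColumn hF i h).2]
    · have h1 := anchor_add_one (F := F) h
      have h2 := anchor_add_one (F := F) (show k < γ i by omega)
      have := hanti i k
      omega
  intro k i j hij hj
  have hkj := anch_pos_iff.1 hj
  have hj1 := anchor_add_one (F := F) hkj
  rcases lt_or_ge (γ i) (γ j) with h | h
  · have key : ∀ k ≤ γ i, F.anchor i k < F.anchor j (k + 1) := by
      intro k
      induction k with
      | zero =>
        intro _
        have := hF.tripleB i j 0 hij h (Nat.zero_le _)
        rw [anchor_zero, anchor_zero, IsInversionTriple] at this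
        rw [anchor_zero]
        omega
      | succ k ih =>
        intro hk
        have h1 := hF.tripleB i j (k + 1) hij h hk
        have h2 := hanchor i k hk
        have h3 := ih (by omega)
        rw [IsInversionTriple] at h1
        omega
    left
    rcases Nat.eq_zero_or_pos (anch F i k) with h0 | h0
    · omega
    · have hki := anch_pos_iff.1 h0
      have h1 := key (k + 1) hki
      have h2 := anchor_add_one (F := F) hki
      omega
  · have h1 := hF.tripleA i j (k + 1) hij h (by omega)
    have h2 := anchor_add_one (F := F) (show k < γ i by omega)
    have h3 := anchor_add_one (F := F) (show k + 1 < γ i by omega)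
    rw [IsInversionTriple] at h1
    omega

/-- Type A triples come directly from greediness; type B triples are recovered from right to left,
starting where the shorter upper row has ended. -/
theorem isSemistandardSkyline_of_isGreedy {F : SetFilling γ} (hF : IsRegular (· < ·) F)
    (hG : IsGreedy (anch F)) (h0 : ∀ i, 0 < anch F i 0 → anch F i 0 = i + 1) :
    IsSemistandardSkyline F := by
  have hfirst : ∀ i, 0 < γ i → F.anchor i 1 = i := fun i hi => by
    have h1 : F.anchor i 1 + 1 = anch F i 0 := anchor_add_one hi
    rw [h0 i (anch_pos_iff.2 hi)] at h1
    omega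
  have hanti := hF.anch_succ_le
  refine ⟨?_, ?_, ?_, ?_, ?_⟩
  · rintro i j (_ | k) hij
    · simpa [SetFilling.box] using hij
    · exact Finset.disjoint_left.2 fun x hi hj => hij (hF.col i j k x hi hj)
  · rintro i (_ | k) x hx y hy
    · obtain rfl : x = i := by simpa [SetFilling.box] using hx
      have h1 := succ_le_anch (F := F) (i := x) (k := 0) hy
      rw [h0 x (by omega)] at h1
      omega
    · exact hF.row i k x hx y hy
  · rintro i j (_ | k) hij h hk
    · rw [anchor_zero, hfirst i (by omega), hfirst j (by omega)]
      exact Or.inl ⟨hij, le_rfl⟩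
    · have h1 := anchor_add_one (F := F) (show k < γ i by omega)
      have h2 := anchor_add_one (F := F) (show k + 1 < γ i by omega)
      have h3 := anchor_add_one (F := F) (show k + 1 < γ j by omega)
      have h4 := hG k i j hij (by omega)
      have h5 := hanti i k
      rw [IsInversionTriple]
      omega
  · rintro i j (_ | k) hij h hk
    · rw [anchor_zero, anchor_zero, hfirst j (by omega)]
      exact Or.inr ⟨le_rfl, hij⟩
    · have key : ∀ d k, k + d = γ i →
          anch F i k < anch F j k ∧ (0 < d → anch F i k < anch F j (k + 1)) := by
        intro d
        induction d with
        | zero =>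
          intro k hk
          have h1 : ¬ 0 < anch F i k := fun h => by
            have := anch_pos_iff.1 h
            omega
          have h2 := (anch_pos_iff (F := F) (i := j) (k := k)).2 (by omega)
          omega
        | succ d ih =>
          intro k hk
          have h1 := ih (k + 1) (by omega)
          have h2 := hanti j k
          have h3 := hG k i j hij (by omega)
          omega
      have h1 := anchor_add_one (F := F) (show k < γ i by omega)
      have h2 := anchor_add_one (F := F) (show k < γ j by omega)
      have h3 := anchor_add_one (F := F) (show k + 1 < γ j by omega)
      have h4 := (key (γ i - k) k (by omega)).2 (by omega)
      have h5 := hanti j k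
      rw [IsInversionTriple]
      omega
  · rintro i k x hx hxa i' hi' ⟨hk', hx', -, hrow⟩
    have h1 := anchor_add_one (F := F) ((F.nonempty_iff i k).1 ⟨x, hx⟩)
    have h2 := anchor_add_one (F := F) (show k < γ i' by omega)
    exact hF.ext i k x hx (by omega) i' hi'
      ⟨Finset.sup_le fun y hy => Nat.succ_le_succ (hrow y hy), by omega⟩

end Regular

/-! ### Fillings and their column data -/

section Columns

variable {γ δ ε : WeakComp} {r : ℕ → ℕ → Prop}

/-- With anchors sorted down each column, strict decrease of whole columns amounts to putting every
free entry into the lowest row that admits it. -/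
theorem isReverseTableau_iff_of_antitone {lam : WeakComp} (hlam : Antitone lam)
    {T : SetFilling lam} :
    IsReverseTableau T ↔ IsRegular (· > ·) T ∧
      ∀ i k, 0 < anch T (i + 1) k → anch T (i + 1) k < anch T i k := by
  constructor
  · intro hT
    have hlt : ∀ i j k, i < j → ∀ x ∈ T.entries i k, ∀ y ∈ T.entries j k, y < x := by
      intro i j k hij
      induction j, hij using Nat.le_induction with
      | base => exact hT.column i k
      | succ j hj ih =>
        intro x hx y hy
        have h1 := (T.nonempty_iff (j + 1) k).1 ⟨y, hy⟩
        obtain ⟨z, hz⟩ := (T.nonempty_iff j k).2 (lt_of_lt_of_le h1 (hlam (Nat.le_succ j)))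
        exact (hT.column j k z hz y hy).trans (ih x hx z hz)
    refine ⟨⟨hT.row, ?_, ?_⟩, ?_⟩
    · intro i j k x hi hj
      rcases lt_trichotomy i j with h | h | h
      · exact absurd (hlt i j k h x hi x hj) (lt_irrefl _)
      · exact h
      · exact absurd (hlt j i k h x hj x hi) (lt_irrefl _)
    · intro i k x hx hxa i' hi' hfit
      obtain ⟨z, hz, hza⟩ := exists_mem_of_anch_pos (Nat.zero_lt_of_lt hfit.2)
      have h1 := hlt i i' k hi' x hx z hz
      have h2 := hfit.2
      omega
    · intro i k h
      obtain ⟨y, hy, hya⟩ := exists_mem_of_anch_pos h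
      have h1 := anch_pos_iff.1 h
      obtain ⟨x, hx⟩ := (T.nonempty_iff i k).2 (lt_of_lt_of_le h1 (hlam (Nat.le_succ i)))
      have h2 := hT.column i k x hx y hy
      have h3 := succ_le_anch hx
      omega
  · rintro ⟨hT, hc⟩
    refine ⟨hT.row, fun i k x hx y hy => ?_⟩
    have hy1 := succ_le_anch hy
    have hx1 := succ_le_anch hx
    -- If x < y, then x is free and also fits one row lower, since the next anchor in that row is
    -- smaller than the next anchor in row i.
    have hyx : y ≤ x := by
      by_contra! hlt
      have h1 := hc i k (by omega)
      have h2 := hT.fits hx (by omega)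
      have h3 := hT.ext i k x hx (by omega) (i + 1) (Nat.lt_succ_self i)
      rw [Fits] at h2 h3
      have h4 := hc i (k + 1) (by omega)
      omega
    refine lt_of_le_of_ne hyx ?_
    rintro rfl
    have := hT.col i (i + 1) k y hx hy
    omega

theorem finite_cells (F : SetFilling γ) (j : ℕ) :
    {p : ℕ × ℕ | j ∈ F.entries p.1 p.2}.Finite := by
  refine ((γ.support.sigma fun i => Finset.range (γ i)).image
    fun p : (_ : ℕ) × ℕ => (p.1, p.2)).finite_toSet.subset ?_
  rintro ⟨i, k⟩ h
  have hk := (F.nonempty_iff i k).1 ⟨j, h⟩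
  refine Finset.mem_coe.2 (Finset.mem_image.2 ⟨⟨i, k⟩, ?_, rfl⟩)
  rw [Finset.mem_sigma, Finset.mem_range, Finsupp.mem_support_iff]
  exact ⟨Nat.ne_zero_of_lt hk, hk⟩

theorem content_apply (F : SetFilling γ) (j : ℕ) :
    F.content j = {p : ℕ × ℕ | j ∈ F.entries p.1 p.2}.ncard := by
  have h1 : F.content j = ∑ p ∈ γ.support.sigma fun i => Finset.range (γ i),
      if j ∈ F.entries p.1 p.2 then 1 else 0 := by
    rw [Finset.sum_sigma, SetFilling.content, Finsupp.finsetSum_apply]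
    refine Finset.sum_congr rfl fun i _ => ?_
    rw [Finsupp.finsetSum_apply]
    refine Finset.sum_congr rfl fun k _ => ?_
    rw [Finsupp.finsetSum_apply]
    simp [Finsupp.single_apply]
  rw [h1, ← Finset.card_filter, ← Set.ncard_coe_finset]
  refine Set.ncard_congr (fun p _ => (p.1, p.2)) ?_ ?_ ?_
  · intro p hp
    exact (Finset.mem_filter.1 (Finset.mem_coe.1 hp)).2
  · rintro ⟨i, k⟩ ⟨i', k'⟩ _ _ h
    obtain ⟨rfl, rfl⟩ := Prod.mk.inj h
    rfl
  · rintro ⟨i, k⟩ h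
    have hk := (F.nonempty_iff i k).1 ⟨j, h⟩
    refine ⟨⟨i, k⟩, Finset.mem_coe.2 (Finset.mem_filter.2 ⟨?_, h⟩), rfl⟩
    rw [Finset.mem_sigma, Finset.mem_range, Finsupp.mem_support_iff]
    exact ⟨Nat.ne_zero_of_lt hk, hk⟩

/-- Two fillings have the same anchors and the same entries in every column. -/
structure SameColumns (F : SetFilling γ) (F' : SetFilling δ) : Prop where
  anch : ∀ k x, 0 < x → ((∃ i, anch F i k = x) ↔ ∃ i, Skyline.anch F' i k = x)
  mem : ∀ k x, (∃ i, x ∈ F.entries i k) ↔ ∃ i, x ∈ F'.entries i k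

theorem SameColumns.symm {F : SetFilling γ} {F' : SetFilling δ} (h : SameColumns F F') :
    SameColumns F' F :=
  ⟨fun k x hx => (h.anch k x hx).symm, fun k x => (h.mem k x).symm⟩

theorem SameColumns.trans {F : SetFilling γ} {F' : SetFilling δ} {F'' : SetFilling ε}
    (h : SameColumns F F') (h' : SameColumns F' F'') : SameColumns F F'' :=
  ⟨fun k x hx => (h.anch k x hx).trans (h'.anch k x hx),
    fun k x => (h.mem k x).trans (h'.mem k x)⟩

/-- Entries do not repeat in a column, so multiplicity counts columns; hence the content depends on
the column data only. -/
theorem IsRegular.content_eq_ncard_columns {F : SetFilling γ} (hF : IsRegular r F) (j : ℕ) :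
    F.content j = {k | ∃ i, j ∈ F.entries i k}.ncard := by
  rw [content_apply]
  refine Set.ncard_congr (fun p _ => p.2) (fun p hp => ⟨p.1, hp⟩) ?_ ?_
  · rintro ⟨i, k⟩ ⟨i', k'⟩ h h' e
    obtain rfl : k = k' := e
    rw [hF.col i i' k j h h']
  · rintro k ⟨i, hi⟩
    exact ⟨(i, k), hi, rfl⟩

theorem SameColumns.content_eq {F : SetFilling γ} {F' : SetFilling δ} {r' : ℕ → ℕ → Prop}
    (hF : IsRegular r F) (hF' : IsRegular r' F') (h : SameColumns F F') :
    F.content = F'.content := by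
  ext j
  rw [hF.content_eq_ncard_columns, hF'.content_eq_ncard_columns]
  congr 1
  ext k
  exact h.mem k j

/-- The number of values of `u` greater than `x`. -/
noncomputable def countAbove (u : ℕ → ℕ) (x : ℕ) : ℕ := {i | x < u i}.ncard

/-- Distinct indices have distinct positive values. -/
def InjPos (u : ℕ → ℕ) : Prop := ∀ i j, u i = u j → 0 < u i → i = j

theorem IsRegular.injPos {F : SetFilling γ} (hF : IsRegular r F) (k : ℕ) :
    InjPos fun i => Skyline.anch F i k :=
  fun _ _ h hpos => hF.anch_inj h hpos

theorem InjPos.countAbove_eq {u : ℕ → ℕ} (hu : InjPos u) (x : ℕ) :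
    countAbove u x = {y | x < y ∧ ∃ i, u i = y}.ncard := by
  refine Set.ncard_congr (fun i _ => u i) (fun i hi => ⟨hi, i, rfl⟩) ?_ ?_
  · intro i j hi _ h
    exact hu i j h (Nat.zero_lt_of_lt hi)
  · rintro y ⟨hy, i, rfl⟩
    exact ⟨i, hy, rfl⟩

theorem countAbove_congr {u v : ℕ → ℕ} (hu : InjPos u) (hv : InjPos v)
    (h : ∀ y, 0 < y → ((∃ i, u i = y) ↔ ∃ i, v i = y)) (x : ℕ) :
    countAbove u x = countAbove v x := by
  rw [hu.countAbove_eq, hv.countAbove_eq]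
  congr 1
  ext y
  exact and_congr_right fun hy => h y (Nat.zero_lt_of_lt hy)

/-- The rows with v i ≤ x < u i are those above x in u but not in v. Their existence is a matter of
counting, independent of how the values are distributed over rows. -/
theorem exists_fits_iff {u v : ℕ → ℕ} (hv : ∀ i, v i ≤ u i) (hfin : {i | 0 < u i}.Finite) (x : ℕ) :
    (∃ i, v i ≤ x ∧ x < u i) ↔ countAbove v x < countAbove u x := by
  have hfu : {i | x < u i}.Finite := hfin.subset fun i hi => Nat.zero_lt_of_lt hi
  have hsub : {i | x < v i} ⊆ {i | x < u i} := fun i hi => lt_of_lt_of_le hi (hv i)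
  constructor
  · rintro ⟨i, h1, h2⟩
    exact Set.ncard_lt_ncard ⟨hsub, fun h => absurd (h h2) (not_lt.2 h1)⟩ hfu
  · intro h
    by_contra! hne
    refine h.ne ?_
    rw [countAbove, countAbove]
    congr 1
    exact hsub.antisymm fun i hi => not_le.1 fun hle => not_lt.2 (hne i hle) hi

theorem finite_anch_pos (F : SetFilling γ) (k : ℕ) : {i | 0 < anch F i k}.Finite := by
  refine γ.support.finite_toSet.subset fun i hi => ?_
  have := anch_pos_iff.1 hi
  exact Finset.mem_coe.2 (Finsupp.mem_support_iff.2 (by omega))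

theorem colLength_eq_countAbove (F : SetFilling γ) (k : ℕ) :
    colLength γ k = countAbove (fun i => anch F i k) 0 := by
  rw [colLength, countAbove, ← Set.ncard_coe_finset]
  congr 1
  ext i
  simp only [Finset.coe_filter, Finsupp.mem_support_iff, Set.mem_ofPred_eq, anch_pos_iff]
  omega

theorem SameColumns.countAbove_eq {F : SetFilling γ} {F' : SetFilling δ} {r' : ℕ → ℕ → Prop}
    (hF : IsRegular r F) (hF' : IsRegular r' F') (h : SameColumns F F') (k x : ℕ) :
    countAbove (fun i => Skyline.anch F i k) x = countAbove (fun i => Skyline.anch F' i k) x :=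
  countAbove_congr (hF.injPos k) (hF'.injPos k) (h.anch k) x

theorem SameColumns.colLength_eq {F : SetFilling γ} {F' : SetFilling δ} {r' : ℕ → ℕ → Prop}
    (hF : IsRegular r F) (hF' : IsRegular r' F') (h : SameColumns F F') (k : ℕ) :
    colLength γ k = colLength δ k := by
  rw [colLength_eq_countAbove F, colLength_eq_countAbove F', h.countAbove_eq hF hF']

/-- A regular filling is determined by its anchors and the entries of its columns. -/
theorem IsRegular.entries_eq (hr : ∀ i j, i ≠ j → r i j ∨ r j i)
    {F : SetFilling γ} {F' : SetFilling δ} (hF : IsRegular r F) (hF' : IsRegular r F')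
    (h : SameColumns F F') (ha : anch F = anch F') : F.entries = F'.entries := by
  have aux : ∀ {γ δ : WeakComp} {F : SetFilling γ} {F' : SetFilling δ}, IsRegular r F →
      IsRegular r F' → SameColumns F F' → anch F = anch F' →
      ∀ i k x, x ∈ F.entries i k → x ∈ F'.entries i k := by
    intro γ δ F F' hF hF' h ha i k x hx
    rcases (succ_le_anch hx).eq_or_lt with he | hlt
    · exact mem_of_anch_eq (by rw [← ha, he])
    · obtain ⟨i', hi'⟩ := (h.mem k x).1 ⟨i, hx⟩
      rcases (succ_le_anch hi').eq_or_lt with he' | hlt'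
      · have hx' := mem_of_anch_eq (F := F) (by rw [ha, he'] : anch F i' k = x + 1)
        rwa [hF.col i i' k x hx hx']
      · by_contra hni
        have hne : i ≠ i' := fun e => hni (e ▸ hi')
        -- The entry is free in both fillings and fits both rows, since the anchors agree; whichever
        -- row comes first contradicts the placement in the other filling.
        rcases hr i i' hne with h1 | h1
        · exact hF'.ext i' k x hi' hlt' i h1 (ha ▸ hF.fits hx hlt)
        · exact hF.ext i k x hx hlt i' h1 (ha ▸ hF'.fits hi' hlt')
  funext i k
  ext x
  exact ⟨aux hF hF' h ha i k x, aux hF' hF h.symm ha.symm i k x⟩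

/-- Every anchor array with the same columns as a given regular filling comes from a regular
filling with the same entries in each column. -/
theorem exists_isRegular (hr : ∀ i j, i ≠ j → r i j ∨ r j i)
    (hmin : ∀ s : Set ℕ, s.Finite → s.Nonempty → ∃ i ∈ s, ∀ i' ∈ s, ¬ r i' i)
    {r' : ℕ → ℕ → Prop} {F : SetFilling γ} (hF : IsRegular r' F) {a : ℕ → ℕ → ℕ}
    (hrow : ∀ i k, a i (k + 1) ≤ a i k) (hinj : ∀ k, InjPos fun i => a i k)
    (hcol : ∀ k x, 0 < x → ((∃ i, anch F i k = x) ↔ ∃ i, a i k = x)) :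
    ∃ (δ : WeakComp) (G : SetFilling δ), IsRegular r G ∧ anch G = a ∧ SameColumns F G := by
  classical
  have hcount : ∀ k x, countAbove (fun i => anch F i k) x = countAbove (fun i => a i k) x :=
    fun k x => countAbove_congr (hF.injPos k) (hinj k) (hcol k) x
  have hfin : ∀ k, {i | 0 < a i k}.Finite := by
    intro k
    refine Set.Finite.of_finite_image (f := fun i => a i k) ?_
      (fun i hi j _ h => hinj k i j h hi)
    refine ((finite_anch_pos F k).image fun i => anch F i k).subset ?_
    rintro _ ⟨i, hi, rfl⟩
    obtain ⟨i', hi'⟩ := (hcol k _ hi).2 ⟨i, rfl⟩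
    exact ⟨i', lt_of_lt_of_eq hi hi'.symm, hi'⟩
  have hanti : ∀ i, Antitone (a i) := fun i => antitone_nat_of_succ_le (hrow i)
  have hzero : ∀ i, ∃ k, a i k = 0 := by
    intro i
    -- No row of F has more than `γ.degree` boxes, so F, and hence a, has no anchor in this column.
    refine ⟨γ.degree, Nat.eq_zero_of_not_pos fun h => ?_⟩
    obtain ⟨i', hi'⟩ := (hcol _ _ h).2 ⟨i, rfl⟩
    have h1 := anch_pos_iff.1 (hi'.symm ▸ h)
    have h2 := Finsupp.le_degree i' γ
    omega
  let δ : WeakComp := Finsupp.onFinset (hfin 0).toFinset (fun i => Nat.find (hzero i))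
    fun i hi => by
      rw [Set.Finite.mem_toFinset]
      by_contra h
      exact hi ((Nat.find_eq_zero _).2 (Nat.eq_zero_of_not_pos h))
  have hδ : ∀ i k, k < δ i ↔ 0 < a i k := by
    intro i k
    change k < Nat.find (hzero i) ↔ _
    rw [Nat.lt_find_iff]
    exact ⟨fun h => Nat.pos_of_ne_zero (h k le_rfl),
      fun h n hn => (lt_of_lt_of_le h (hanti i hn)).ne'⟩
  -- A box receives its anchor and those non-anchor entries of the column for which its row is the
  -- r-first one admitting them.
  let P : ℕ → ℕ → ℕ → Prop := fun i k x => x + 1 = a i k ∨ ((∃ i', x ∈ F.entries i' k) ∧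
    (∀ i', a i' k ≠ x + 1) ∧ Fits a i k x ∧ ∀ i', r i' i → ¬ Fits a i' k x)
  have hPle : ∀ {i k x}, P i k x → x + 1 ≤ a i k := by
    rintro i k x (h | ⟨-, -, h, -⟩)
    · exact h.le
    · exact h.2.le
  have hPge : ∀ {i k x}, P i k x → a i (k + 1) ≤ x + 1 := by
    rintro i k x (h | ⟨-, -, h, -⟩)
    · exact h ▸ hrow i k
    · exact h.1
  let G : SetFilling δ :=
    { entries := fun i k => (Finset.range (a i k)).filter (P i k)
      nonempty_iff := fun i k => by
        rw [hδ]
        constructor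
        · rintro ⟨x, hx⟩
          exact Nat.zero_lt_of_lt (Finset.mem_range.1 (Finset.mem_filter.1 hx).1)
        · intro h
          exact ⟨a i k - 1, Finset.mem_filter.2 ⟨Finset.mem_range.2 (by omega),
            Or.inl (by omega)⟩⟩ }
  have hmem : ∀ {i k x}, x ∈ G.entries i k ↔ P i k x := by
    intro i k x
    refine ⟨fun h => (Finset.mem_filter.1 h).2, fun h => Finset.mem_filter.2
      ⟨Finset.mem_range.2 (hPle h), h⟩⟩
  have hanch : ∀ i k, anch G i k = a i k := by
    intro i k
    refine le_antisymm (Finset.sup_le fun x hx => hPle (hmem.1 hx)) ?_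
    rcases Nat.eq_zero_or_pos (a i k) with h | h
    · omega
    · have := succ_le_anch (hmem.2 (Or.inl (by omega) : P i k (a i k - 1)))
      omega
  have hanch' : anch G = a := funext fun i => funext fun k => hanch i k
  refine ⟨δ, G, ⟨?_, ?_, ?_⟩, hanch', ⟨?_, ?_⟩⟩
  · intro i k x hx y hy
    have h1 := hPle (hmem.1 hy)
    have h2 := hPge (hmem.1 hx)
    omega
  · intro i j k x hi hj
    rcases hmem.1 hi with h | ⟨-, hn, hf, he⟩ <;> rcases hmem.1 hj with h' | ⟨-, hn', hf', he'⟩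
    · exact hinj k i j (by dsimp only; omega) (by dsimp only; omega)
    · exact absurd h.symm (hn' i)
    · exact absurd h'.symm (hn j)
    · by_contra hne
      rcases hr i j hne with h | h
      · exact he' i h hf
      · exact he j h hf'
  · intro i k x hx hlt i' hi'
    rw [hanch] at hlt
    rw [hanch']
    rcases hmem.1 hx with h | ⟨-, -, -, he⟩
    · omega
    · exact he i' hi'
  · intro k x hx
    rw [hanch']
    exact hcol k x hx
  · intro k x
    constructor
    · rintro ⟨i, hi⟩
      by_cases hc : ∃ i', a i' k = x + 1
      · obtain ⟨i', hi'⟩ := hc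
        exact ⟨i', hmem.2 (Or.inl hi'.symm)⟩
      · have hlt : x + 1 < anch F i k := by
          refine lt_of_le_of_ne (succ_le_anch hi) fun h => hc ?_
          exact (hcol k _ (Nat.succ_pos x)).1 ⟨i, h.symm⟩
        -- The entry fits somewhere in F; equal anchor counts transfer this to the array a.
        have hfit := (exists_fits_iff (fun i => hF.anch_succ_le i k) (finite_anch_pos F k)
          (x + 1)).1 ⟨i, hF.fits hi hlt⟩
        rw [hcount, hcount] at hfit
        have hex := (exists_fits_iff (fun i => hrow i k) (hfin k) (x + 1)).2 hfit
        obtain ⟨i', hi', hext⟩ := hmin {i | Fits a i k x}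
          ((hfin k).subset fun i hi => Nat.zero_lt_of_lt hi.2) hex
        exact ⟨i', hmem.2 (Or.inr ⟨⟨i, hi⟩, fun i' h => hc ⟨i', h⟩, hi',
          fun j hj hfj => hext j hfj hj⟩)⟩
    · rintro ⟨i, hi⟩
      rcases hmem.1 hi with h | ⟨h, -⟩
      · obtain ⟨i', hi'⟩ := (hcol k _ (Nat.succ_pos x)).2 ⟨i, h.symm⟩
        exact ⟨i', mem_of_anch_eq hi'⟩
      · exact h

end Columns

/-! ### Greedy and sorted arrangements of the anchors -/

section Arrays

/-- `v` is a column that may follow the column `u` in the anchor array of a skyline filling. -/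
structure IsGreedyColumn (u v : ℕ → ℕ) : Prop where
  le : ∀ i, v i ≤ u i
  inj : InjPos v
  greedy : ∀ i j, i < j → 0 < v j → u i < v j ∨ v j < v i

/-- The values are inserted in decreasing order, each into the highest unoccupied row whose left
neighbour is large enough. The counting hypothesis is a Hall condition guaranteeing such a row. -/
theorem exists_isGreedyColumn (u : ℕ → ℕ) (D : Finset ℕ) (h0 : 0 ∉ D)
    (hD : ∀ x, (D.filter (x < ·)).card ≤ countAbove u x) :
    ∃ v, IsGreedyColumn u v ∧ ∀ y, 0 < y → ((∃ i, v i = y) ↔ y ∈ D) := by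
  classical
  induction D using Finset.induction_on_min with
  | empty => exact ⟨0, ⟨by simp, fun i j _ h => absurd h (by simp), by simp⟩, fun y hy => by
      simp [hy.ne]⟩
  | insert a s has ih =>
    have ha : 0 < a := Nat.pos_of_ne_zero fun h => h0 (by simp [h])
    have hanot : a ∉ s := fun h => lt_irrefl _ (has a h)
    obtain ⟨v, hv, hvs⟩ := ih (fun h => h0 (by simp [h])) fun x =>
      (Finset.card_le_card (Finset.filter_subset_filter _ (Finset.subset_insert _ _))).trans (hD x)
    have hvlt : ∀ i, 0 < v i → a < v i := fun i hi => has _ ((hvs _ hi).1 ⟨i, rfl⟩)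
    -- Otherwise the rows with u i ≥ a are exactly those occupied by s, one fewer than the
    -- hypothesis at a - 1 requires.
    have hex : ∃ i, a ≤ u i ∧ v i = 0 := by
      by_contra! hne
      have h1 := hD (a - 1)
      rw [Finset.filter_true_of_mem, Finset.card_insert_of_notMem hanot] at h1
      · have h2 : countAbove u (a - 1) = countAbove v 0 := by
          rw [countAbove, countAbove]
          congr 1
          ext i
          have h3 := hne i
          have h4 := hvlt i
          have h5 := hv.le i
          simp only [Set.mem_ofPred_eq]
          omega
        have h3 : countAbove v 0 = s.card := by
          rw [hv.inj.countAbove_eq, ← Set.ncard_coe_finset]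
          congr 1
          ext y
          constructor
          · rintro ⟨hy, hi⟩
            exact (hvs y hy).1 hi
          · intro hy
            have hy0 : 0 < y := ha.trans (has y hy)
            exact ⟨hy0, (hvs y hy0).2 hy⟩
        omega
      · intro y hy
        rcases Finset.mem_insert.1 hy with rfl | hy
        · omega
        · have := has y hy
          omega
    obtain ⟨hr1, hr2⟩ := Nat.find_spec hex
    have hr3 : ∀ i < Nat.find hex, ¬ (a ≤ u i ∧ v i = 0) := fun i hi => Nat.find_min hex hi
    generalize Nat.find hex = r at hr1 hr2 hr3
    refine ⟨Function.update v r a, ⟨?_, ?_, ?_⟩, ?_⟩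
    · intro i
      rcases eq_or_ne i r with rfl | hi
      · rwa [Function.update_self]
      · rw [Function.update_of_ne hi]
        exact hv.le i
    · intro i j hij hpos
      rcases eq_or_ne i r with hi | hi <;> rcases eq_or_ne j r with hj | hj
      · rw [hi, hj]
      · rw [hi, Function.update_self, Function.update_of_ne hj] at hij
        have := hvlt j (by omega)
        omega
      · rw [hj, Function.update_self, Function.update_of_ne hi] at hij
        have := hvlt i (by omega)
        omega
      · rw [Function.update_of_ne hi, Function.update_of_ne hj] at hij
        rw [Function.update_of_ne hi] at hpos
        exact hv.inj i j hij hpos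
    · intro i j hij hpos
      rcases eq_or_ne j r with rfl | hj
      · rw [Function.update_self, Function.update_of_ne hij.ne]
        have h1 := hr3 i hij
        have h2 := hvlt i
        omega
      · rw [Function.update_of_ne hj] at hpos ⊢
        have h1 := hv.greedy i j hij hpos
        rcases eq_or_ne i r with rfl | hi
        · omega
        · rwa [Function.update_of_ne hi]
    · intro y hy
      rw [Finset.mem_insert, ← hvs y hy]
      constructor
      · rintro ⟨i, hi⟩
        rcases eq_or_ne i r with rfl | hir
        · rw [Function.update_self] at hi
          exact Or.inl hi.symm
        · rw [Function.update_of_ne hir] at hi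
          exact Or.inr ⟨i, hi⟩
      · rintro (rfl | ⟨i, hi⟩)
        · exact ⟨r, Function.update_self ..⟩
        · refine ⟨i, ?_⟩
          rw [Function.update_of_ne, hi]
          rintro rfl
          omega

/-- Compare the columns from the largest value down: if y sits higher in one of them, greediness of
the other puts a larger value into that row, and larger values already agree. -/
theorem IsGreedyColumn.unique {u v v' : ℕ → ℕ} (hv : IsGreedyColumn u v)
    (hv' : IsGreedyColumn u v') (hfin : {i | 0 < u i}.Finite)
    (h : ∀ y, 0 < y → ((∃ i, v i = y) ↔ ∃ i, v' i = y)) : v = v' := by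
  obtain ⟨B, hB⟩ : ∃ B, ∀ i, u i ≤ B := by
    obtain ⟨B, hB⟩ := (hfin.image u).bddAbove
    refine ⟨B, fun i => ?_⟩
    rcases Nat.eq_zero_or_pos (u i) with h0 | h0
    · omega
    · exact hB ⟨i, h0, rfl⟩
  -- Induction on B - y, with B a bound for u, is downward induction on the value y.
  have key : ∀ n y, B - y = n → 0 < y → ∀ j j', v j = y → v' j' = y → j = j' := by
    intro n
    induction n using Nat.strong_induction_on with
    | _ n ih =>
      intro y hn hy j j' hj hj'
      have h1 := hv.le j
      have h2 := hv'.le j'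
      rcases lt_trichotomy j j' with hlt | heq | hlt
      · have h3 := hv'.greedy j j' hlt (by omega)
        have h4 := hv'.le j
        have h5 := hB j
        obtain ⟨l, hl⟩ := (h (v' j) (by omega)).2 ⟨j, rfl⟩
        have := ih (B - v' j) (by omega) (v' j) rfl (by omega) l j hl rfl
        subst this
        omega
      · exact heq
      · have h3 := hv.greedy j' j hlt (by omega)
        have h4 := hv.le j'
        have h5 := hB j'
        obtain ⟨l, hl⟩ := (h (v j') (by omega)).1 ⟨j', rfl⟩
        have := ih (B - v j') (by omega) (v j') rfl (by omega) j' l rfl hl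
        subst this
        omega
  funext i
  rcases Nat.eq_zero_or_pos (v i) with h0 | h0
  · rcases Nat.eq_zero_or_pos (v' i) with h0' | h0'
    · omega
    · obtain ⟨l, hl⟩ := (h _ h0').2 ⟨i, rfl⟩
      have := key _ _ rfl h0' l i hl rfl
      subst this
      exact hl
  · obtain ⟨l, hl⟩ := (h _ h0).1 ⟨i, rfl⟩
    have := key _ _ rfl h0 i l rfl hl
    subst this
    exact hl.symm

variable {γ δ : WeakComp} {r : ℕ → ℕ → Prop}

/-- The anchors of column `k`. -/
noncomputable def anchorSet (F : SetFilling γ) (k : ℕ) : Finset ℕ :=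
  (γ.support.image fun i => anch F i k).erase 0

theorem mem_anchorSet {F : SetFilling γ} {k y : ℕ} (hy : 0 < y) :
    y ∈ anchorSet F k ↔ ∃ i, anch F i k = y := by
  rw [anchorSet, Finset.mem_erase, Finset.mem_image]
  constructor
  · rintro ⟨-, i, -, hi⟩
    exact ⟨i, hi⟩
  · rintro ⟨i, hi⟩
    have := anch_pos_iff.1 (hi.symm ▸ hy)
    exact ⟨hy.ne', i, Finsupp.mem_support_iff.2 (by omega), hi⟩

theorem IsRegular.countAbove_succ_le {F : SetFilling γ} (hF : IsRegular r F) (k x : ℕ) :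
    countAbove (fun i => anch F i (k + 1)) x ≤ countAbove (fun i => anch F i k) x :=
  Set.ncard_le_ncard (fun i hi => lt_of_lt_of_le hi (hF.anch_succ_le i k))
    ((finite_anch_pos F k).subset fun _ hi => Nat.zero_lt_of_lt hi)

/-- The first column is forced by the basement. The later ones are built recursively; the Hall
condition holds because the rows of F decrease and anchor counts do not depend on the arrangement.
-/
theorem exists_isGreedy_array {F : SetFilling γ} (hF : IsRegular r F) :
    ∃ a : ℕ → ℕ → ℕ, (∀ i k, a i (k + 1) ≤ a i k) ∧ (∀ k, InjPos fun i => a i k) ∧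
      (∀ k x, 0 < x → ((∃ i, anch F i k = x) ↔ ∃ i, a i k = x)) ∧ IsGreedy a ∧
      ∀ i, 0 < a i 0 → a i 0 = i + 1 := by
  classical
  let step : ℕ → (ℕ → ℕ) → ℕ → ℕ := fun k u =>
    if h : ∃ v, IsGreedyColumn u v ∧ ∀ y, 0 < y → ((∃ i, v i = y) ↔ y ∈ anchorSet F (k + 1)) then
      h.choose else 0
  let c : ℕ → ℕ → ℕ := fun k =>
    Nat.rec (fun i => if i + 1 ∈ anchorSet F 0 then i + 1 else 0) step k
  have hc0 : ∀ i, c 0 i = if i + 1 ∈ anchorSet F 0 then i + 1 else 0 := fun _ => rfl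
  have hstep : ∀ k, c (k + 1) = step k (c k) := fun _ => rfl
  have hnext : ∀ k, InjPos (c k) → (∀ y, 0 < y → ((∃ i, c k i = y) ↔ y ∈ anchorSet F k)) →
      IsGreedyColumn (c k) (c (k + 1)) ∧
        ∀ y, 0 < y → ((∃ i, c (k + 1) i = y) ↔ y ∈ anchorSet F (k + 1)) := by
    intro k hinj hval
    have hex := exists_isGreedyColumn (c k) (anchorSet F (k + 1)) (by simp [anchorSet]) (by
      intro x
      rw [← countAbove_congr (hF.injPos k) hinj
        (fun y hy => (mem_anchorSet hy).symm.trans (hval y hy).symm)]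
      refine le_trans (le_of_eq ?_) (hF.countAbove_succ_le k x)
      rw [(hF.injPos (k + 1)).countAbove_eq, ← Set.ncard_coe_finset]
      congr 1
      ext y
      rw [Finset.mem_coe, Finset.mem_filter, and_comm]
      exact and_congr_right fun hy => mem_anchorSet (Nat.zero_lt_of_lt hy))
    rw [hstep]
    simp only [step]
    rw [dif_pos hex]
    exact hex.choose_spec
  have hall : ∀ k, InjPos (c k) ∧ ∀ y, 0 < y → ((∃ i, c k i = y) ↔ y ∈ anchorSet F k) := by
    intro k
    induction k with
    | zero =>
      constructor
      · intro i j hij hpos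
        rw [hc0] at hpos hij
        rw [hc0] at hij
        split_ifs at hij hpos <;> omega
      · intro y hy
        constructor
        · rintro ⟨i, hi⟩
          rw [hc0] at hi
          split_ifs at hi with h
          · exact hi ▸ h
          · omega
        · intro h
          obtain ⟨i, rfl⟩ : ∃ i, y = i + 1 := ⟨y - 1, by omega⟩
          exact ⟨i, by rw [hc0, if_pos h]⟩
    | succ k ih =>
      obtain ⟨h1, h2⟩ := hnext k ih.1 ih.2
      exact ⟨h1.inj, h2⟩
  have hcol : ∀ k, IsGreedyColumn (c k) (c (k + 1)) := fun k =>
    (hnext k (hall k).1 (hall k).2).1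
  refine ⟨fun i k => c k i, fun i k => (hcol k).le i, fun k => (hall k).1, fun k x hx => ?_,
    fun k => (hcol k).greedy, fun i hi => ?_⟩
  · rw [(hall k).2 x hx, mem_anchorSet hx]
  · dsimp only at hi ⊢
    rw [hc0] at hi ⊢
    split_ifs at hi ⊢ with h
    · rfl
    · omega

theorem anch_eq_of_isGreedy {r' : ℕ → ℕ → Prop} {F : SetFilling γ} {F' : SetFilling δ}
    (hF : IsRegular r F) (hF' : IsRegular r' F') (h : SameColumns F F')
    (hG : IsGreedy (anch F)) (hG' : IsGreedy (anch F'))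
    (h0 : ∀ i, 0 < anch F i 0 → anch F i 0 = i + 1)
    (h0' : ∀ i, 0 < anch F' i 0 → anch F' i 0 = i + 1) : anch F = anch F' := by
  have aux : ∀ {γ δ : WeakComp} {F : SetFilling γ} {F' : SetFilling δ}, SameColumns F F' →
      (∀ i, 0 < anch F i 0 → anch F i 0 = i + 1) →
      (∀ i, 0 < anch F' i 0 → anch F' i 0 = i + 1) →
      ∀ i, 0 < anch F i 0 → anch F i 0 = anch F' i 0 := by
    intro γ δ F F' h h0 h0' i hi
    obtain ⟨i', hi'⟩ := (h.anch 0 _ hi).1 ⟨i, rfl⟩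
    have h1 := h0 i hi
    have h2 := h0' i' (by omega)
    obtain rfl : i = i' := by omega
    exact hi'.symm
  have hk : ∀ k, (fun i => anch F i k) = fun i => anch F' i k := by
    intro k
    induction k with
    | zero =>
      funext i
      have h1 := aux h h0 h0' i
      have h2 := aux h.symm h0' h0 i
      omega
    | succ k ih =>
      refine IsGreedyColumn.unique (u := fun i => anch F i k)
        ⟨fun i => hF.anch_succ_le i k, hF.injPos _, hG k⟩ ?_ (finite_anch_pos F k) (h.anch (k + 1))
      rw [ih]
      exact ⟨fun i => hF'.anch_succ_le i k, hF'.injPos _, hG' k⟩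
  funext i k
  exact congrFun (hk k) i

/-- The values of `u` decrease strictly, until they vanish. -/
def StrictAntiPos (u : ℕ → ℕ) : Prop := ∀ i, 0 < u (i + 1) → u (i + 1) < u i

theorem StrictAntiPos.lt {u : ℕ → ℕ} (hu : StrictAntiPos u) {i j : ℕ} (hij : i < j)
    (hj : 0 < u j) : u j < u i := by
  induction j, hij using Nat.le_induction with
  | base => exact hu i hj
  | succ j hj' ih =>
    have := hu j hj
    exact this.trans (ih (by omega))

theorem StrictAntiPos.injPos {u : ℕ → ℕ} (hu : StrictAntiPos u) : InjPos u := by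
  intro i j hij hpos
  rcases lt_trichotomy i j with h | h | h
  · have := hu.lt h (by omega)
    omega
  · exact h
  · have := hu.lt h hpos
    omega

/-- The entries exceeding x occupy an initial segment of rows, so a sorted column is determined by
its counts. -/
theorem StrictAntiPos.lt_iff {u : ℕ → ℕ} (hu : StrictAntiPos u) (hfin : {i | 0 < u i}.Finite)
    (i x : ℕ) : x < u i ↔ i < countAbove u x := by
  have hfx : {i | x < u i}.Finite := hfin.subset fun i hi => Nat.zero_lt_of_lt hi
  constructor
  · intro h
    have hsub : (Finset.range (i + 1) : Set ℕ) ⊆ {i | x < u i} := by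
      intro j hj
      rcases (Nat.lt_succ_iff.1 (Finset.mem_range.1 (Finset.mem_coe.1 hj))).eq_or_lt with rfl | hj
      · exact h
      · exact h.trans (hu.lt hj (Nat.zero_lt_of_lt h))
    have := Set.ncard_le_ncard hsub hfx
    rw [Set.ncard_coe_finset, Finset.card_range] at this
    exact this
  · intro h
    by_contra hx
    have hsub : {i | x < u i} ⊆ (Finset.range i : Set ℕ) := by
      intro j hj
      rw [Finset.mem_coe, Finset.mem_range]
      by_contra! hle
      rcases hle.eq_or_lt with rfl | hlt
      · exact hx hj
      · exact hx (lt_trans hj (hu.lt hlt (Nat.zero_lt_of_lt hj)))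
    have := Set.ncard_le_ncard hsub (Finset.finite_toSet _)
    rw [Set.ncard_coe_finset, Finset.card_range] at this
    exact absurd h (not_lt.2 this)

theorem anch_eq_of_strictAntiPos {r' : ℕ → ℕ → Prop} {F : SetFilling γ} {F' : SetFilling δ}
    (hF : IsRegular r F) (hF' : IsRegular r' F') (h : SameColumns F F')
    (hS : ∀ k, StrictAntiPos fun i => anch F i k) (hS' : ∀ k, StrictAntiPos fun i => anch F' i k) :
    anch F = anch F' := by
  funext i k
  refine eq_of_forall_lt_iff fun x => ?_
  rw [(hS k).lt_iff (finite_anch_pos F k), (hS' k).lt_iff (finite_anch_pos F' k),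
    h.countAbove_eq hF hF']

/-- Sorting each column of anchors keeps rows weakly decreasing, because the counts above any x
weakly decrease from column to column. -/
theorem exists_strictAntiPos_array {F : SetFilling γ} (hF : IsRegular r F) :
    ∃ a : ℕ → ℕ → ℕ, (∀ i k, a i (k + 1) ≤ a i k) ∧ (∀ k, StrictAntiPos fun i => a i k) ∧
      (∀ k x, 0 < x → ((∃ i, anch F i k = x) ↔ ∃ i, a i k = x)) := by
  classical
  set N : ℕ → ℕ → ℕ := fun k x => countAbove (fun i => anch F i k) x with hN
  have hfin : ∀ k x, {i | x < anch F i k}.Finite := fun k x =>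
    (finite_anch_pos F k).subset fun i hi => Nat.zero_lt_of_lt hi
  have hNanti : ∀ k, Antitone (N k) := fun k x y hxy =>
    Set.ncard_le_ncard (fun i hi => lt_of_le_of_lt hxy hi) (hfin k x)
  have hNsucc : ∀ k x, N k x ≤ N k (x + 1) + 1 := by
    intro k x
    have hsub : {i | x < anch F i k} ⊆ {i | x + 1 < anch F i k} ∪ {i | anch F i k = x + 1} := by
      intro i hi
      rcases (Nat.succ_le_of_lt hi).eq_or_lt with h | h
      · exact Or.inr h.symm
      · exact Or.inl h
    have hss : {i | anch F i k = x + 1}.Subsingleton := fun i hi j hj =>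
      hF.anch_inj (hi.trans hj.symm) (hi.symm ▸ Nat.succ_pos x)
    refine (Set.ncard_le_ncard hsub ((hfin k _).union hss.finite)).trans
      ((Set.ncard_union_le _ _).trans (Nat.add_le_add_left ?_ _))
    exact (Set.ncard_le_one hss.finite).2 hss
  have hNlt : ∀ k x, N k (x + 1) < N k x ↔ ∃ i, anch F i k = x + 1 := by
    intro k x
    constructor
    · intro h
      by_contra! hne
      refine h.not_ge (Set.ncard_le_ncard (fun i hi => ?_) (hfin k _))
      exact lt_of_le_of_ne hi (hne i).symm
    · rintro ⟨i, hi⟩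
      exact Set.ncard_lt_ncard ⟨fun j hj => Nat.lt_of_succ_lt hj, fun h =>
        absurd (h (show x < anch F i k by omega)) (show ¬ x + 1 < anch F i k by omega)⟩ (hfin k _)
  have hex : ∀ i k, ∃ x, N k x ≤ i := by
    intro i k
    obtain ⟨B, hB⟩ := ((finite_anch_pos F k).image fun i => anch F i k).bddAbove
    refine ⟨B, le_of_eq_of_le ?_ (Nat.zero_le i)⟩
    have : {i | B < anch F i k} = ∅ := Set.eq_empty_iff_forall_notMem.2 fun i hi =>
      not_lt.2 (hB ⟨i, Nat.zero_lt_of_lt hi, rfl⟩) hi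
    simp only [hN, countAbove]
    rw [this, Set.ncard_empty]
  -- This is the anchor of rank i in column k, counting from the largest and from 0; it is 0 once
  -- the anchors are exhausted.
  let a : ℕ → ℕ → ℕ := fun i k => Nat.find (hex i k)
  have ha : ∀ i k x, x < a i k ↔ i < N k x := by
    intro i k x
    rw [Nat.lt_find_iff]
    exact ⟨fun h => not_le.1 (h x le_rfl), fun h y hy => not_le.2 (h.trans_le (hNanti k hy))⟩
  refine ⟨a, fun i k => ?_, fun k i hi => ?_, fun k x hx => ?_⟩
  · refine le_of_forall_lt fun x hx => ?_
    rw [ha] at hx ⊢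
    exact hx.trans_le (hF.countAbove_succ_le k x)
  · dsimp only at hi ⊢
    obtain ⟨x, hx⟩ : ∃ x, a (i + 1) k = x + 1 := ⟨a (i + 1) k - 1, by omega⟩
    have h1 := (ha (i + 1) k x).1 (by omega)
    have h2 := hNsucc k x
    have h3 := (ha i k (x + 1)).2 (by omega)
    omega
  · obtain ⟨x, rfl⟩ : ∃ y, x = y + 1 := ⟨x - 1, by omega⟩
    rw [← hNlt]
    constructor
    · intro h
      refine ⟨N k (x + 1), ?_⟩
      have h1 := (ha (N k (x + 1)) k x).2 h
      have h2 := (ha (N k (x + 1)) k (x + 1)).not.2 (lt_irrefl _)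
      omega
    · rintro ⟨i, hi⟩
      have h1 := (ha i k x).1 (by omega)
      have h2 := (ha i k (x + 1)).not.1 (by omega)
      omega

end Arrays

/-! ### The bijection between skyline fillings and reverse tableaux -/

section Bijection

variable {γ δ : WeakComp}

theorem SetSkyFill.eq_of_sameColumns {F : SetFilling γ} {F' : SetFilling δ}
    (hF : IsSemistandardSkyline F) (hF' : IsSemistandardSkyline F') (h : SameColumns F F') :
    γ = δ ∧ F.entries = F'.entries := by
  have ha := anch_eq_of_isGreedy hF.isRegular hF'.isRegular h hF.isGreedy hF'.isGreedy
    (fun _ => hF.anch_zero) (fun _ => hF'.anch_zero)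
  refine ⟨?_, hF.isRegular.entries_eq (fun i j h => Nat.lt_or_gt_of_ne h) hF'.isRegular h ha⟩
  ext i
  refine eq_of_forall_lt_iff fun k => ?_
  rw [← anch_pos_iff (F := F), ← anch_pos_iff (F := F'), ha]

theorem SetRT.eq_of_sameColumns {lam : Partition} {T T' : SetRT lam.1}
    (h : SameColumns T.1 T'.1) : T = T' := by
  obtain ⟨hT, hs⟩ := (isReverseTableau_iff_of_antitone lam.2).1 T.2
  obtain ⟨hT', hs'⟩ := (isReverseTableau_iff_of_antitone lam.2).1 T'.2
  have ha := anch_eq_of_strictAntiPos hT hT' h (fun k i => hs i k) (fun k i => hs' i k)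
  exact Subtype.ext (SetFilling.ext
    (hT.entries_eq (fun i j h => Nat.lt_or_gt_of_ne h.symm) hT' h ha))

theorem exists_skyline_sameColumns {lam : Partition} (T : SetRT lam.1) :
    ∃ γ, partitionOf γ = lam ∧ ∃ F : SetSkyFill γ, SameColumns F.1 T.1 := by
  obtain ⟨hT, -⟩ := (isReverseTableau_iff_of_antitone lam.2).1 T.2
  obtain ⟨a, hrow, hinj, hcol, hG, h0⟩ := exists_isGreedy_array hT
  obtain ⟨γ, F, hF, rfl, hFT⟩ := exists_isRegular (r := (· < ·))
    (fun i j h => Nat.lt_or_gt_of_ne h)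
    (fun s _ hs => ⟨sInf s, Nat.sInf_mem hs, fun i hi => not_lt.2 (Nat.sInf_le hi)⟩)
    hT hrow hinj hcol
  exact ⟨γ, partitionOf_eq_of_colLength_eq (hFT.symm.colLength_eq hF hT),
    ⟨F, isSemistandardSkyline_of_isGreedy hF hG h0⟩, hFT.symm⟩

/-- The anchors are sorted and the free entries reinserted as low as possible. Column lengths are
preserved, which identifies the resulting shape with lam. -/
theorem exists_tableau_sameColumns (F : SetSkyFill γ) {lam : Partition}
    (hlam : partitionOf γ = lam) : ∃ T : SetRT lam.1, SameColumns F.1 T.1 := by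
  obtain ⟨a, hrow, hs, hcol⟩ := exists_strictAntiPos_array F.2.isRegular
  obtain ⟨μ, T, hT, rfl, hFT⟩ := exists_isRegular (r := (· > ·))
    (fun i j h => Nat.lt_or_gt_of_ne h.symm)
    (fun s hs hs' => by
      obtain ⟨i, hi, hmax⟩ := Set.exists_max_image s id hs hs'
      exact ⟨i, hi, fun j hj => not_lt.2 (hmax j hj)⟩)
    F.2.isRegular hrow (fun k => (hs k).injPos) hcol
  have hμ : Antitone μ := antitone_nat_of_succ_le fun i => le_of_forall_lt fun k hk => by
    rw [← anch_pos_iff (F := T)] at hk ⊢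
    exact hk.trans (hs k i hk)
  have heq : partitionOf γ = ⟨μ, hμ⟩ :=
    partitionOf_eq_of_colLength_eq (hFT.colLength_eq F.2.isRegular hT)
  obtain rfl := hlam.symm.trans heq
  exact ⟨⟨T, (isReverseTableau_iff_of_antitone hμ).2 ⟨hT, fun i k => hs k i⟩⟩, hFT⟩

/-- Set-valued skyline fillings of the rearrangements of `lam` correspond to set-valued reverse
tableaux of shape `lam`, with the same entries in each column. -/
noncomputable def skylineEquiv (lam : Partition) :
    (Σ γ : {γ : WeakComp // partitionOf γ = lam}, SetSkyFill γ.1) ≃ SetRT lam.1 :=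
  Equiv.ofBijective (fun F => (exists_tableau_sameColumns F.2 F.1.2).choose) (by
    have hspec := fun F : Σ γ : {γ : WeakComp // partitionOf γ = lam}, SetSkyFill γ.1 =>
      (exists_tableau_sameColumns F.2 F.1.2).choose_spec
    constructor
    · intro F F' h
      have h1 := hspec F
      have h2 := hspec F'
      dsimp only at h
      rw [← h] at h2
      obtain ⟨⟨γ, hγ⟩, F⟩ := F
      obtain ⟨⟨δ, hδ⟩, F'⟩ := F'
      obtain ⟨h3, h4⟩ := SetSkyFill.eq_of_sameColumns F.2 F'.2 (h1.trans h2.symm)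
      dsimp only at h3
      subst h3
      obtain rfl : F = F' := Subtype.ext (SetFilling.ext h4)
      rfl
    · intro T
      obtain ⟨γ, hγ, F, hF⟩ := exists_skyline_sameColumns T
      refine ⟨⟨⟨γ, hγ⟩, F⟩, ?_⟩
      exact SetRT.eq_of_sameColumns ((hspec ⟨⟨γ, hγ⟩, F⟩).symm.trans hF))

theorem skylineEquiv_sameColumns {lam : Partition}
    (F : Σ γ : {γ : WeakComp // partitionOf γ = lam}, SetSkyFill γ.1) :
    SameColumns F.2.1 (skylineEquiv lam F).1 :=
  (exists_tableau_sameColumns F.2 F.1.2).choose_spec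

variable {R : Type*} [CommRing R]

theorem fillingTerm_eq_of_content_eq (β : R) {F : SetFilling γ} {F' : SetFilling δ}
    (h : F.content = F'.content) (hd : γ.degree = δ.degree) :
    fillingTerm β F = fillingTerm β F' := by
  rw [fillingTerm, fillingTerm, h, hd]

/-- Tableaux are grouped by the shape of the corresponding skyline filling. Equal columns give equal
contents, and rearranged shapes have equal degree, so the powers of β agree too. -/
theorem coeff_grothendieck (β : R) (lam : Partition) (m : WeakComp) :
    MvPowerSeries.coeff m (grothendieck β lam) =
      ∑ᶠ γ : {γ // partitionOf γ = lam}, MvPowerSeries.coeff m (lascouxAtom β γ.1) := by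
  have h1 : MvPowerSeries.coeff m (grothendieck β lam) =
      ∑ᶠ F, MvPowerSeries.coeff m (fillingTerm β (skylineEquiv lam F).1) :=
    (finsum_comp_equiv (skylineEquiv lam)
      (f := fun T => MvPowerSeries.coeff m (fillingTerm β T.1))).symm
  have hfin : (Function.support fun F =>
      MvPowerSeries.coeff m (fillingTerm β (skylineEquiv lam F).1)).Finite :=
    (coeff_fillingTerm_support β _ m).preimage (skylineEquiv lam).injective.injOn
  rw [h1, finsum_fiberwise Sigma.fst _ hfin]
  refine finsum_congr fun γ => ?_
  refine (finsum_eq_of_bijective (fun F : SetSkyFill γ.1 => ⟨⟨γ, F⟩, rfl⟩) ⟨?_, ?_⟩ ?_).symm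
  · intro F F' h
    simpa using h
  · rintro ⟨⟨γ', F⟩, rfl⟩
    exact ⟨F, rfl⟩
  · intro F
    congr 1
    have h2 := skylineEquiv_sameColumns (lam := lam) ⟨γ, F⟩
    refine fillingTerm_eq_of_content_eq β (h2.content_eq F.2.isRegular
      ((isReverseTableau_iff_of_antitone lam.2).1 (skylineEquiv lam ⟨γ, F⟩).2).1) ?_
    rw [degree_eq_sum_parts, degree_eq_sum_parts]
    congr 1
    exact parts_eq_of_partitionOf_eq (γ.2.trans (partitionOf_coe lam).symm)

end Bijection

/-! ### Unitriangularity of the Lascoux atoms -/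

section Triangularity

variable {γ : WeakComp}

/-- Both sides count triples (j, k, l) with j in V k and in V l. -/
theorem sum_card_filter_sq (V : ℕ → Finset ℕ) (S : Finset ℕ) (K : ℕ) (hV : ∀ k, V k ⊆ S) :
    ∑ j ∈ S, ((Finset.range K).filter (j ∈ V ·)).card ^ 2 =
      ∑ k ∈ Finset.range K, ∑ l ∈ Finset.range K, (V k ∩ V l).card := by
  have h1 : ∀ j ∈ S, ((Finset.range K).filter (j ∈ V ·)).card ^ 2 =
      ∑ k ∈ Finset.range K, ∑ l ∈ Finset.range K, if j ∈ V k ∩ V l then 1 else 0 := by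
    intro j _
    rw [Finset.card_filter, sq, Finset.sum_mul_sum]
    refine Finset.sum_congr rfl fun k _ => Finset.sum_congr rfl fun l _ => ?_
    simp only [Finset.mem_inter]
    split_ifs <;> simp_all
  rw [Finset.sum_congr rfl h1, Finset.sum_comm]
  refine Finset.sum_congr rfl fun k _ => ?_
  rw [Finset.sum_comm]
  refine Finset.sum_congr rfl fun l _ => ?_
  rw [← Finset.card_filter, Finset.filter_mem_eq_inter, Finset.inter_eq_right.2]
  exact Finset.inter_subset_left.trans (hV k)

/-- Each of the `γ.degree` boxes has at least one entry, so equality of degrees leaves no room for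
free entries. -/
theorem card_entries_eq_one {F : SetFilling γ} (h : F.content.degree ≤ γ.degree) {i k : ℕ}
    (hk : k < γ i) : (F.entries i k).card = 1 := by
  have hone : ∀ i, ∀ k ∈ Finset.range (γ i), 1 ≤ (F.entries i k).card := fun i k hk =>
    Finset.card_pos.2 ((F.nonempty_iff i k).2 (Finset.mem_range.1 hk))
  have hsum : F.content.degree = ∑ i ∈ γ.support, ∑ k ∈ Finset.range (γ i),
      (F.entries i k).card := by
    simp [SetFilling.content, map_sum]
  have hdeg : γ.degree = ∑ i ∈ γ.support, ∑ k ∈ Finset.range (γ i), 1 := by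
    simp [Finsupp.degree_apply]
  have hle : ∀ i ∈ γ.support, ∑ k ∈ Finset.range (γ i), 1 ≤
      ∑ k ∈ Finset.range (γ i), (F.entries i k).card := fun i _ => Finset.sum_le_sum (hone i)
  have heq := (Finset.sum_eq_sum_iff_of_le hle).1
    (le_antisymm (Finset.sum_le_sum hle) (by rw [← hsum, ← hdeg]; exact h))
  have hi : i ∈ γ.support := Finsupp.mem_support_iff.2 (by omega)
  exact ((Finset.sum_eq_sum_iff_of_le (hone i)).1 (heq i hi) k (Finset.mem_range.2 hk)).symm

/-- Suppose column k is constant along rows, and row i drops to x + 1 < i + 1 in column k + 1. By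
nestedness row x has anchor x + 1 in column k, so greediness would have put x + 1 at least that
high. -/
theorem anch_eq_of_nested {F : SetFilling γ} (hF : IsSemistandardSkyline F)
    (hn : ∀ k x, (∃ i, anch F i (k + 1) = x + 1) → ∃ i, anch F i k = x + 1) (k : ℕ) :
    ∀ i, 0 < anch F i k → anch F i k = i + 1 := by
  have hanti := hF.isRegular.anch_succ_le
  induction k with
  | zero => exact fun i => hF.anch_zero
  | succ k ih =>
    intro i hi
    obtain ⟨x, hx⟩ : ∃ x, anch F i (k + 1) = x + 1 := ⟨anch F i (k + 1) - 1, by omega⟩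
    have h1 := hanti i k
    have h2 := ih i (by omega)
    by_contra hne
    obtain ⟨i', hi'⟩ := hn k x ⟨i, hx⟩
    have h3 := ih i' (by omega)
    have h4 := hF.isGreedy k i' i (by omega) hi
    have h5 := hanti i' k
    omega

/-- Compare the column entry sets U with the column row sets W. They have equal sizes and W is
nested, so the sum of squares of γ is the largest possible; attaining it forces U to be nested. -/
theorem IsSemistandardSkyline.entries_eq {F : SetFilling γ} (hF : IsSemistandardSkyline F)
    (hdeg : F.content.degree ≤ γ.degree) (hsq : sumSq γ ≤ sumSq F.content) (i k : ℕ) :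
    F.entries i k = if k < γ i then {i} else ∅ := by
  classical
  have hanch : ∀ {i k x}, x ∈ F.entries i k → x + 1 = anch F i k := by
    intro i k x hx
    have hk := (F.nonempty_iff i k).1 ⟨x, hx⟩
    obtain ⟨y, hy⟩ := Finset.card_eq_one.1 (card_entries_eq_one hdeg hk)
    obtain ⟨z, hz, hza⟩ := exists_mem_of_anch_pos (anch_pos_iff.2 hk)
    rw [hy, Finset.mem_singleton] at hx hz
    omega
  set K := γ.degree with hK
  have hlt : ∀ {i k}, k < γ i → k < K := fun {i k} h => h.trans_le (Finsupp.le_degree i γ)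
  set U : ℕ → Finset ℕ := fun k => F.content.support.filter fun j => ∃ i, j ∈ F.entries i k with hU
  set W : ℕ → Finset ℕ := fun k => γ.support.filter (k < γ ·) with hW
  have hmemU : ∀ {k j}, j ∈ U k ↔ ∃ i, j ∈ F.entries i k := by
    intro k j
    simp only [hU, Finset.mem_filter, and_iff_right_iff_imp]
    rintro ⟨i, hi⟩
    exact mem_support_content F hi
  have hmemW : ∀ {k i}, i ∈ W k ↔ k < γ i := by
    intro k i
    simp only [hW, Finset.mem_filter, Finsupp.mem_support_iff, and_iff_right_iff_imp]
    omega
  have hcard : ∀ k, (U k).card = (W k).card := by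
    intro k
    have hpos : ∀ {i}, i ∈ W k → 0 < anch F i k := fun h => anch_pos_iff.2 (hmemW.1 h)
    refine (Finset.card_nbij (fun i => anch F i k - 1) ?_ ?_ ?_).symm
    · intro i hi
      have := hpos hi
      exact hmemU.2 ⟨i, mem_of_anch_eq (Nat.sub_add_cancel this).symm⟩
    · intro i hi j hj h
      have h1 := hpos (Finset.mem_coe.1 hi)
      have h2 := hpos (Finset.mem_coe.1 hj)
      dsimp only at h
      exact hF.isRegular.anch_inj (k := k) (by omega) h1
    · intro x hx
      obtain ⟨i, hi⟩ := hmemU.1 (Finset.mem_coe.1 hx)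
      refine ⟨i, Finset.mem_coe.2 (hmemW.2 ((F.nonempty_iff i k).1 ⟨x, hi⟩)), ?_⟩
      have := hanch hi
      dsimp only
      omega
  have hsqU : sumSq F.content =
      ∑ k ∈ Finset.range K, ∑ l ∈ Finset.range K, (U k ∩ U l).card := by
    rw [← sum_card_filter_sq U F.content.support K fun k => Finset.filter_subset _ _, sumSq,
      Finsupp.sum]
    refine Finset.sum_congr rfl fun j _ => ?_
    rw [hF.isRegular.content_eq_ncard_columns, ← Set.ncard_coe_finset]
    congr 2
    ext k
    simp only [Finset.coe_filter, Finset.mem_range, Set.mem_ofPred_eq, hmemU, iff_and_self]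
    rintro ⟨i, hi⟩
    exact hlt ((F.nonempty_iff i k).1 ⟨j, hi⟩)
  have hsqW : sumSq γ = ∑ k ∈ Finset.range K, ∑ l ∈ Finset.range K, (W k ∩ W l).card := by
    rw [← sum_card_filter_sq W γ.support K fun k => Finset.filter_subset _ _, sumSq,
      Finsupp.sum]
    refine Finset.sum_congr rfl fun i _ => ?_
    rw [← Finset.card_range (γ i)]
    congr 2
    ext k
    simp only [Finset.mem_filter, Finset.mem_range, hmemW, iff_and_self]
    exact hlt
  have hWanti : Antitone W := fun k l hkl i hi => hmemW.2 (hkl.trans_lt (hmemW.1 hi))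
  -- The intersection in W is the smaller of the two nested columns, whose size bounds any
  -- intersection in U.
  have hle : ∀ k l, (U k ∩ U l).card ≤ (W k ∩ W l).card := by
    intro k l
    rcases le_total k l with h | h
    · rw [Finset.inter_eq_right.2 (hWanti h), ← hcard]
      exact Finset.card_le_card Finset.inter_subset_right
    · rw [Finset.inter_eq_left.2 (hWanti h), ← hcard]
      exact Finset.card_le_card Finset.inter_subset_left
  have heq : ∀ k < K, ∀ l < K, (U k ∩ U l).card = (W k ∩ W l).card := by
    rw [hsqU, hsqW] at hsq
    have h1 := (Finset.sum_eq_sum_iff_of_le (s := Finset.range K) fun k _ =>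
      Finset.sum_le_sum (s := Finset.range K) fun l _ => hle k l).1 (le_antisymm
        (Finset.sum_le_sum fun k _ => Finset.sum_le_sum fun l _ => hle k l) hsq)
    intro k hk l hl
    exact (Finset.sum_eq_sum_iff_of_le fun l _ => hle k l).1 (h1 k (Finset.mem_range.2 hk)) l
      (Finset.mem_range.2 hl)
  have hnested : ∀ k x, (∃ i, anch F i (k + 1) = x + 1) → ∃ i, anch F i k = x + 1 := by
    rintro k x ⟨i, hi⟩
    have hk : k + 1 < K := hlt (anch_pos_iff.1 (by omega : 0 < anch F i (k + 1)))
    have h1 := heq k (by omega) (k + 1) hk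
    rw [Finset.inter_eq_right.2 (hWanti (Nat.le_succ k)), ← hcard] at h1
    have h2 := Finset.eq_of_subset_of_card_le Finset.inter_subset_right h1.ge
    have h3 : x ∈ U (k + 1) := hmemU.2 ⟨i, mem_of_anch_eq hi⟩
    rw [← h2, Finset.mem_inter] at h3
    obtain ⟨i', hi'⟩ := hmemU.1 h3.1
    exact ⟨i', (hanch hi').symm⟩
  split_ifs with hk
  · have h1 := anch_eq_of_nested hF hnested k i (anch_pos_iff.2 hk)
    ext x
    rw [Finset.mem_singleton]
    constructor
    · intro hx
      have := hanch hx
      omega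
    · rintro rfl
      exact mem_of_anch_eq h1
  · exact Finset.not_nonempty_iff_eq_empty.1 fun h => hk ((F.nonempty_iff i k).1 h)

/-- The filling of shape `γ` with entry `i` in all boxes of row `i`. -/
def constFilling (γ : WeakComp) : SetFilling γ where
  entries i k := if k < γ i then {i} else ∅
  nonempty_iff i k := by
    split_ifs with h <;> simp [h]

theorem mem_constFilling {i k x : ℕ} :
    x ∈ (constFilling γ).entries i k ↔ x = i ∧ k < γ i := by
  simp only [constFilling]
  split_ifs with h <;> simp [h]

theorem content_eq_of_entries_eq {r : ℕ → ℕ → Prop} {F : SetFilling γ} (hF : IsRegular r F)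
    (h : ∀ i k, F.entries i k = if k < γ i then {i} else ∅) : F.content = γ := by
  ext j
  rw [hF.content_eq_ncard_columns]
  conv_rhs => rw [← Finset.card_range (γ j), ← Set.ncard_coe_finset]
  congr 1
  ext k
  rw [Finset.mem_coe, Finset.mem_range]
  constructor
  · rintro ⟨i, hi⟩
    rw [h] at hi
    split_ifs at hi with hk
    · rwa [Finset.mem_singleton.1 hi]
    · simp at hi
  · intro hk
    exact ⟨j, by rw [h, if_pos hk]; exact Finset.mem_singleton_self j⟩

theorem constFilling_isSemistandardSkyline (γ : WeakComp) :
    IsSemistandardSkyline (constFilling γ) := by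
  have hle : ∀ i k, anch (constFilling γ) i k ≤ i + 1 := fun i k =>
    Finset.sup_le fun x hx => (mem_constFilling.1 hx).1 ▸ le_rfl
  have heq : ∀ i k, 0 < anch (constFilling γ) i k → anch (constFilling γ) i k = i + 1 :=
    fun i k h => le_antisymm (hle i k)
      (succ_le_anch (mem_constFilling.2 ⟨rfl, anch_pos_iff.1 h⟩))
  refine isSemistandardSkyline_of_isGreedy ⟨?_, ?_, ?_⟩ ?_ fun i => heq i 0
  · intro i k x hx y hy
    rw [(mem_constFilling.1 hx).1, (mem_constFilling.1 hy).1]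
  · intro i j k x hi hj
    rw [← (mem_constFilling.1 hi).1, ← (mem_constFilling.1 hj).1]
  · intro i k x hx h
    have h1 := (mem_constFilling.1 hx).1
    have h2 := hle i k
    omega
  · intro k i j hij hj
    have h1 := heq j (k + 1) hj
    have h2 := hle i k
    omega

variable {R : Type*} [CommRing R]

theorem exists_of_coeff_lascouxAtom_ne_zero {β : R} {m : WeakComp}
    (h : MvPowerSeries.coeff m (lascouxAtom β γ) ≠ 0) :
    ∃ F : SetSkyFill γ, F.1.content = m := by
  by_contra! hne
  refine h ((finsum_congr fun F => ?_).trans finsum_zero)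
  exact MvPowerSeries.coeff_monomial_ne (hne F).symm _

theorem lascouxAtom_isTriangular (β : R) : IsTriangular (lascouxAtom β) where
  finite := lascouxAtom_locallyFinite β
  degree_le m γ h := by
    obtain ⟨F, rfl⟩ := exists_of_coeff_lascouxAtom_ne_zero h
    exact degree_le_degree_content F.1
  sumSq_lt m γ h hdeg hne := by
    obtain ⟨F, rfl⟩ := exists_of_coeff_lascouxAtom_ne_zero h
    by_contra! hle
    exact hne (content_eq_of_entries_eq F.2.isRegular (F.2.entries_eq hdeg.ge hle))
  diag m := by
    have hm := constFilling_isSemistandardSkyline m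
    have hcm : (constFilling m).content = m :=
      content_eq_of_entries_eq hm.isRegular fun _ _ => rfl
    have huniq : ∀ F : SetSkyFill m, F ≠ ⟨constFilling m, hm⟩ →
        MvPowerSeries.coeff m (fillingTerm β F.1) = 0 := by
      intro F hne
      refine MvPowerSeries.coeff_monomial_ne (fun h => hne ?_) _
      refine Subtype.ext (SetFilling.ext ?_)
      funext i k
      exact F.2.entries_eq (h ▸ le_rfl) (h ▸ le_rfl) i k
    change ∑ᶠ F : SetSkyFill m, MvPowerSeries.coeff m (fillingTerm β F.1) = 1
    rw [finsum_eq_single _ _ huniq, fillingTerm, hcm, MvPowerSeries.coeff_monomial_same,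
      Nat.sub_self, pow_zero]

end Triangularity

/-! ### Increasing relabellings and quasisymmetry -/

section Transport

variable {γ : WeakComp} {φ : ℕ → ℕ}

theorem mapDomain_eq_zero {i : ℕ} (hi : i ∉ Set.range φ) (γ : WeakComp) :
    γ.mapDomain φ i = 0 :=
  Finsupp.mapDomain_of_notMem_range γ i hi

/-- Relabel the rows and the entries of a filling along `φ`. -/
noncomputable def pushFilling (hφ : StrictMono φ) (F : SetFilling γ) :
    SetFilling (γ.mapDomain φ) where
  entries i k := Function.extend φ (fun i => (F.entries i k).image φ) (fun _ => ∅) i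
  nonempty_iff i k := by
    by_cases hi : i ∈ Set.range φ
    · obtain ⟨i, rfl⟩ := hi
      rw [hφ.injective.extend_apply, Finset.image_nonempty, F.nonempty_iff,
        Finsupp.mapDomain_apply hφ.injective]
    · rw [Function.extend_apply' _ _ _ hi, mapDomain_eq_zero hi]
      simp

theorem pushFilling_entries (hφ : StrictMono φ) (F : SetFilling γ) (i k : ℕ) :
    (pushFilling hφ F).entries (φ i) k = (F.entries i k).image φ :=
  hφ.injective.extend_apply (fun i => (F.entries i k).image φ) (fun _ => ∅) i

theorem mem_pushFilling {hφ : StrictMono φ} {F : SetFilling γ} {i k x : ℕ} :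
    x ∈ (pushFilling hφ F).entries i k ↔ ∃ i' x', φ i' = i ∧ φ x' = x ∧ x' ∈ F.entries i' k := by
  constructor
  · intro hx
    by_cases hi : i ∈ Set.range φ
    · obtain ⟨i, rfl⟩ := hi
      rw [pushFilling_entries, Finset.mem_image] at hx
      obtain ⟨x', hx', rfl⟩ := hx
      exact ⟨i, x', rfl, rfl, hx'⟩
    · simp [pushFilling, Function.extend_apply' _ _ _ hi] at hx
  · rintro ⟨i, x, rfl, rfl, hx⟩
    rw [pushFilling_entries]
    exact Finset.mem_image_of_mem φ hx

theorem map_mem_pushFilling {hφ : StrictMono φ} {F : SetFilling γ} {i k x : ℕ} :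
    φ x ∈ (pushFilling hφ F).entries (φ i) k ↔ x ∈ F.entries i k := by
  rw [pushFilling_entries, hφ.injective.mem_finset_image]

/-- The map induced by `φ` on entries plus one, with `0` fixed. -/
def shiftMap (φ : ℕ → ℕ) : ℕ → ℕ
  | 0 => 0
  | x + 1 => φ x + 1

theorem shiftMap_strictMono (hφ : StrictMono φ) : StrictMono (shiftMap φ) := by
  rintro (_ | x) (_ | y) h
  · omega
  · exact Nat.succ_pos _
  · omega
  · exact Nat.succ_lt_succ (hφ (by omega))

theorem anch_pushFilling (hφ : StrictMono φ) (F : SetFilling γ) (i k : ℕ) :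
    anch (pushFilling hφ F) (φ i) k = shiftMap φ (anch F i k) := by
  rw [anch, pushFilling_entries, Finset.sup_image, anch,
    Finset.apply_sup_eq_sup_comp_of_linearOrder _ (shiftMap_strictMono hφ).monotone rfl]
  rfl

theorem anch_pushFilling_pos {hφ : StrictMono φ} {F : SetFilling γ} {i k : ℕ}
    (h : 0 < anch (pushFilling hφ F) i k) : ∃ i', φ i' = i := by
  obtain ⟨x, hx, -⟩ := exists_mem_of_anch_pos h
  obtain ⟨i', -, hi', -⟩ := mem_pushFilling.1 hx
  exact ⟨i', hi'⟩

theorem fits_pushFilling (hφ : StrictMono φ) (F : SetFilling γ) (i k x : ℕ) :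
    Fits (anch (pushFilling hφ F)) (φ i) k (φ x) ↔ Fits (anch F) i k x := by
  have hx : φ x + 1 = shiftMap φ (x + 1) := rfl
  rw [Fits, anch_pushFilling, anch_pushFilling, hx, (shiftMap_strictMono hφ).le_iff_le,
    (shiftMap_strictMono hφ).lt_iff_lt, Fits]

/-- In the regular and greedy form, all conditions are comparisons of rows and of entries, which φ
preserves and reflects; rows outside its range are empty. The basement is relabelled in the same way
as the entries. -/
theorem isSemistandardSkyline_pushFilling {hφ : StrictMono φ} {F : SetFilling γ} :
    IsSemistandardSkyline (pushFilling hφ F) ↔ IsSemistandardSkyline F := by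
  have hψ := shiftMap_strictMono hφ
  have hψ0 : ∀ {n}, 0 < shiftMap φ n ↔ 0 < n := fun {n} => hψ.lt_iff_lt (a := 0)
  constructor
  · intro h
    have hreg := h.isRegular
    refine isSemistandardSkyline_of_isGreedy ⟨?_, ?_, ?_⟩ ?_ ?_
    · intro i k x hx y hy
      exact hφ.le_iff_le.1 (hreg.row _ _ _ (map_mem_pushFilling.2 hx) _
        (map_mem_pushFilling.2 hy))
    · intro i j k x hi hj
      exact hφ.injective (hreg.col _ _ _ _ (map_mem_pushFilling.2 hi)
        (map_mem_pushFilling.2 hj))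
    · intro i k x hx hlt i' hi' hfit
      refine hreg.ext (φ i) k (φ x) (map_mem_pushFilling.2 hx) ?_ (φ i') (hφ hi')
        ((fits_pushFilling hφ F i' k x).2 hfit)
      rw [anch_pushFilling]
      exact hψ hlt
    · intro k i j hij hj
      have := h.isGreedy k (φ i) (φ j) (hφ hij)
      rw [anch_pushFilling, anch_pushFilling, anch_pushFilling, hψ0, hψ.lt_iff_lt,
        hψ.lt_iff_lt] at this
      exact this hj
    · intro i hi
      have := h.anch_zero (i := φ i)
      rw [anch_pushFilling, hψ0] at this
      exact hψ.injective (this hi)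
  · intro h
    have hreg := h.isRegular
    refine isSemistandardSkyline_of_isGreedy ⟨?_, ?_, ?_⟩ ?_ ?_
    · intro i k x hx y hy
      obtain ⟨i, x, rfl, rfl, hx'⟩ := mem_pushFilling.1 hx
      obtain ⟨i', y, hi', rfl, hy'⟩ := mem_pushFilling.1 hy
      obtain rfl := hφ.injective hi'
      exact hφ.monotone (hreg.row _ _ _ hx' _ hy')
    · intro i j k x hi hj
      obtain ⟨i, x, rfl, rfl, hi'⟩ := mem_pushFilling.1 hi
      obtain ⟨j, y, rfl, hy, hj'⟩ := mem_pushFilling.1 hj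
      obtain rfl := hφ.injective hy
      exact congrArg φ (hreg.col _ _ _ _ hi' hj')
    · intro i k x hx hlt i' hi' hfit
      obtain ⟨i, x, rfl, rfl, hx'⟩ := mem_pushFilling.1 hx
      obtain ⟨i', rfl⟩ := anch_pushFilling_pos (Nat.zero_lt_of_lt hfit.2)
      rw [fits_pushFilling] at hfit
      rw [anch_pushFilling] at hlt
      exact hreg.ext i k x hx' (hψ.lt_iff_lt.1 hlt) i' (hφ.lt_iff_lt.1 hi') hfit
    · intro k i j hij hj
      obtain ⟨j, rfl⟩ := anch_pushFilling_pos hj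
      rcases Nat.eq_zero_or_pos (anch (pushFilling hφ F) i k) with h0 | h0
      · omega
      · obtain ⟨i, rfl⟩ := anch_pushFilling_pos h0
        rw [anch_pushFilling, hψ0] at hj
        rw [anch_pushFilling, anch_pushFilling, anch_pushFilling, hψ.lt_iff_lt, hψ.lt_iff_lt]
        exact h.isGreedy k i j (hφ.lt_iff_lt.1 hij) hj
    · intro i hi
      obtain ⟨i, rfl⟩ := anch_pushFilling_pos hi
      rw [anch_pushFilling, hψ0] at hi
      rw [anch_pushFilling, h.anch_zero hi]
      rfl

theorem content_pushFilling (hφ : StrictMono φ) (F : SetFilling γ) :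
    (pushFilling hφ F).content = F.content.mapDomain φ := by
  ext j
  by_cases hj : j ∈ Set.range φ
  · obtain ⟨j, rfl⟩ := hj
    rw [Finsupp.mapDomain_apply hφ.injective, content_apply, content_apply]
    refine (Set.ncard_congr (fun p _ => (φ p.1, p.2)) ?_ ?_ ?_).symm
    · rintro ⟨i, k⟩ h
      exact map_mem_pushFilling.2 h
    · rintro ⟨i, k⟩ ⟨i', k'⟩ _ _ h
      rw [Prod.mk.injEq] at h ⊢
      exact ⟨hφ.injective h.1, h.2⟩
    · rintro ⟨i, k⟩ h
      obtain ⟨i, x, rfl, hx, h'⟩ := mem_pushFilling.1 h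
      obtain rfl := hφ.injective hx
      exact ⟨(i, k), h', rfl⟩
  · rw [mapDomain_eq_zero hj, content_apply, Set.ncard_eq_zero (finite_cells _ j)]
    refine Set.eq_empty_iff_forall_notMem.2 fun p hp => ?_
    obtain ⟨-, x, -, hx, -⟩ := mem_pushFilling.1 hp
    exact hj ⟨x, hx⟩

theorem pushFilling_injective (hφ : StrictMono φ) :
    Function.Injective (pushFilling hφ : SetFilling γ → _) := by
  intro F F' h
  refine SetFilling.ext (funext fun i => funext fun k => ?_)
  ext x
  rw [← map_mem_pushFilling (hφ := hφ), h, map_mem_pushFilling]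

/-- The hypothesis on the content keeps all entries in the range of φ, so they can be pulled back.
-/
theorem exists_pushFilling_eq (hφ : StrictMono φ) (F : SetFilling (γ.mapDomain φ))
    {m : WeakComp} (hF : F.content = m.mapDomain φ) : ∃ F', pushFilling hφ F' = F := by
  have hrange : ∀ {i k x}, x ∈ F.entries i k → x ∈ Set.range φ := by
    intro i k x hx
    by_contra h
    have h1 := Finsupp.mem_support_iff.1 (mem_support_content F hx)
    rw [hF, mapDomain_eq_zero h] at h1
    exact h1 rfl
  refine ⟨⟨fun i k => (F.entries (φ i) k).preimage φ hφ.injective.injOn, fun i k => ?_⟩, ?_⟩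
  · rw [← Finsupp.mapDomain_apply hφ.injective γ i, ← F.nonempty_iff]
    constructor
    · rintro ⟨x, hx⟩
      exact ⟨φ x, Finset.mem_preimage.1 hx⟩
    · rintro ⟨x, hx⟩
      obtain ⟨x, rfl⟩ := hrange hx
      exact ⟨x, Finset.mem_preimage.2 hx⟩
  · refine SetFilling.ext (funext fun i => funext fun k => ?_)
    ext x
    rw [mem_pushFilling]
    constructor
    · rintro ⟨i, x, rfl, rfl, hx⟩
      exact (Finset.mem_preimage (hf := hφ.injective.injOn)).1 hx
    · intro hx
      obtain ⟨y, rfl⟩ := hrange hx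
      by_cases hi : i ∈ Set.range φ
      · obtain ⟨i, rfl⟩ := hi
        exact ⟨i, y, rfl, rfl, (Finset.mem_preimage (hf := hφ.injective.injOn)).2 hx⟩
      · have := (F.nonempty_iff i k).1 ⟨_, hx⟩
        rw [mapDomain_eq_zero hi] at this
        omega

theorem finsum_eq_finsum_comp {ι κ M : Type*} [AddCommMonoid M] {e : ι → κ}
    (he : Function.Injective e) {h : κ → M} (h0 : ∀ x, x ∉ Set.range e → h x = 0) :
    ∑ᶠ x, h x = ∑ᶠ i, h (e i) := by
  rw [← finsum_mem_range he, ← finsum_mem_univ h]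
  refine finsum_mem_inter_support_eq h _ _ ?_
  ext x
  simp only [Set.univ_inter, Function.mem_support, Set.mem_inter_iff]
  exact ⟨fun hx => ⟨by_contra fun hne => hx (h0 x hne), hx⟩, fun hx => hx.2⟩

variable {R : Type*} [CommRing R]

theorem coeff_mapDomain_lascouxAtom (β : R) (hφ : StrictMono φ) (m : WeakComp) :
    MvPowerSeries.coeff (m.mapDomain φ) (lascouxAtom β (γ.mapDomain φ)) =
      MvPowerSeries.coeff m (lascouxAtom β γ) := by
  change ∑ᶠ F : SetSkyFill (γ.mapDomain φ), MvPowerSeries.coeff _ (fillingTerm β F.1) =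
    ∑ᶠ F : SetSkyFill γ, MvPowerSeries.coeff _ (fillingTerm β F.1)
  let e : SetSkyFill γ → SetSkyFill (γ.mapDomain φ) := fun F =>
    ⟨pushFilling hφ F.1, isSemistandardSkyline_pushFilling.2 F.2⟩
  have he : Function.Injective e := fun F F' h =>
    Subtype.ext (pushFilling_injective hφ (congrArg Subtype.val h))
  rw [finsum_eq_finsum_comp he]
  · refine finsum_congr fun F => ?_
    have hdeg : ∀ δ : WeakComp, (δ.mapDomain φ).degree = δ.degree := fun δ => by
      rw [degree_eq_sum_parts, parts_mapDomain hφ.injective, ← degree_eq_sum_parts]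
    simp only [e, fillingTerm, content_pushFilling, hdeg]
    classical
    simp only [MvPowerSeries.coeff_monomial,
      (Finsupp.mapDomain_injective hφ.injective).eq_iff]
  · intro F hF
    refine MvPowerSeries.coeff_monomial_ne (fun h => hF ?_) _
    obtain ⟨F', hF'⟩ := exists_pushFilling_eq hφ F.1 h.symm
    exact ⟨⟨F', isSemistandardSkyline_pushFilling.1 (hF'.symm ▸ F.2)⟩, Subtype.ext hF'⟩

theorem isClassInvariant_quasiGrothendieck (β : R) (α : Comp) :
    IsClassInvariant plus (quasiGrothendieck β α) := by
  refine isClassInvariant_plus fun φ hφ m => ?_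
  change ∑ᶠ γ : {γ : WeakComp // plus γ = α.1}, MvPowerSeries.coeff _ (lascouxAtom β γ.1) =
    ∑ᶠ γ : {γ : WeakComp // plus γ = α.1}, MvPowerSeries.coeff _ (lascouxAtom β γ.1)
  let e : {γ : WeakComp // plus γ = α.1} → {γ : WeakComp // plus γ = α.1} := fun γ =>
    ⟨γ.1.mapDomain φ, (plus_mapDomain hφ γ.1).trans γ.2⟩
  have he : Function.Injective e := fun γ γ' h =>
    Subtype.ext (Finsupp.mapDomain_injective hφ.injective (congrArg Subtype.val h))
  rw [finsum_eq_finsum_comp he]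
  · exact finsum_congr fun γ => coeff_mapDomain_lascouxAtom β hφ m
  · rintro ⟨γ, hγ⟩ hne
    by_contra h
    obtain ⟨F, hF⟩ := exists_of_coeff_lascouxAtom_ne_zero h
    -- The first box of a nonempty row i contains i, so the content controls which rows can occur.
    have hsupp : (γ.support : Set ℕ) ⊆ Set.range φ := by
      intro i hi
      have hpos : 0 < γ i := Nat.pos_of_ne_zero (Finsupp.mem_support_iff.1 (Finset.mem_coe.1 hi))
      have h1 := Finsupp.mem_support_iff.1
        (mem_support_content F.1 (mem_firstColumn F.2 i hpos).1)
      by_contra hr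
      rw [hF, mapDomain_eq_zero hr] at h1
      exact h1 rfl
    have hmap := Finsupp.mapDomain_comapDomain φ hφ.injective γ hsupp
    refine hne ⟨⟨γ.comapDomain φ hφ.injective.injOn, ?_⟩, Subtype.ext hmap⟩
    rw [← plus_mapDomain hφ, hmap, hγ]

end Transport

/-! ### A set-valued Bender–Knuth involution -/

section BenderKnuth

variable {lam : WeakComp}

theorem IsReverseTableau.row_le {T : SetFilling lam} (hT : IsReverseTableau T) {i k l x y : ℕ}
    (hkl : k < l) (hx : x ∈ T.entries i k) (hy : y ∈ T.entries i l) : y ≤ x := by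
  induction l, hkl using Nat.le_induction generalizing y with
  | base => exact hT.row i k x hx y hy
  | succ l hl ih =>
    obtain ⟨z, hz⟩ := (T.nonempty_iff i l).2
      (lt_trans (Nat.lt_succ_self l) ((T.nonempty_iff i (l + 1)).1 ⟨y, hy⟩))
    exact (hT.row i l z hz y hy).trans (ih hz)

/-- Box `(i, k)` contains `a` or `a + 1`, but it does not belong to a vertical pair of boxes, the
upper one containing `a + 1` and the lower one containing `a`. -/
def IsUnpaired (T : SetFilling lam) (a i k : ℕ) : Prop :=
  (a ∈ T.entries i k ∨ a + 1 ∈ T.entries i k) ∧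
    ¬ (a + 1 ∈ T.entries i k ∧ a ∈ T.entries (i + 1) k) ∧
    ∀ i', i' + 1 = i → ¬ (a ∈ T.entries i k ∧ a + 1 ∈ T.entries i' k)

/-- The reflection of the columns of the unpaired boxes of row `i`. -/
noncomputable def reflectCol (T : SetFilling lam) (a i k : ℕ) : ℕ :=
  sInf {k | IsUnpaired T a i k} + sSup {k | IsUnpaired T a i k} - k

variable {T : SetFilling lam} {a : ℕ}

theorem IsUnpaired.lt {i k : ℕ} (h : IsUnpaired T a i k) : k < lam i :=
  h.1.elim (fun h => (T.nonempty_iff i k).1 ⟨_, h⟩) fun h => (T.nonempty_iff i k).1 ⟨_, h⟩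

theorem IsUnpaired.notMem_below (hT : IsReverseTableau T) {i k : ℕ} (h : IsUnpaired T a i k) :
    a ∉ T.entries (i + 1) k ∧ a + 1 ∉ T.entries (i + 1) k := by
  obtain ⟨h1, h2, -⟩ := h
  rcases h1 with h1 | h1
  · refine ⟨fun h => ?_, fun h => ?_⟩
    · have := hT.column i k _ h1 _ h
      omega
    · have := hT.column i k _ h1 _ h
      omega
  · refine ⟨fun h => h2 ⟨h1, h⟩, fun h => ?_⟩
    have := hT.column i k _ h1 _ h
    omega

theorem IsUnpaired.notMem_above (hT : IsReverseTableau T) {i k : ℕ}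
    (h : IsUnpaired T a (i + 1) k) : a ∉ T.entries i k ∧ a + 1 ∉ T.entries i k := by
  obtain ⟨h1, -, h2⟩ := h
  rcases h1 with h1 | h1
  · refine ⟨fun h => ?_, fun h => h2 i rfl ⟨h1, h⟩⟩
    have := hT.column i k _ h _ h1
    omega
  · refine ⟨fun h => ?_, fun h => ?_⟩
    · have := hT.column i k _ h _ h1
      omega
    · have := hT.column i k _ h _ h1
      omega

/-- In a box left of a paired box with `a + 1`, the entry `a + 1` is paired as well. -/
theorem IsReverseTableau.pair_left (hT : IsReverseTableau T) {i k l : ℕ} (hkl : k < l)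
    (hb : a + 1 ∈ T.entries i k) (ha : a ∈ T.entries (i + 1) l) : a ∈ T.entries (i + 1) k := by
  obtain ⟨w, hw⟩ := (T.nonempty_iff (i + 1) k).2
    (hkl.trans ((T.nonempty_iff (i + 1) l).1 ⟨_, ha⟩))
  have h1 := hT.column i k _ hb _ hw
  have h2 := hT.row_le hkl hw ha
  obtain rfl : w = a := by omega
  exact hw

/-- In a box right of a paired box with `a`, the entry `a` is paired as well. -/
theorem IsReverseTableau.pair_right (hlam : Antitone lam) (hT : IsReverseTableau T) {i k l : ℕ}
    (hkl : k < l) (hb : a + 1 ∈ T.entries i k) (ha : a ∈ T.entries (i + 1) l) :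
    a + 1 ∈ T.entries i l := by
  obtain ⟨w, hw⟩ := (T.nonempty_iff i l).2
    (lt_of_lt_of_le ((T.nonempty_iff (i + 1) l).1 ⟨_, ha⟩) (hlam (Nat.le_succ i)))
  have h1 := hT.column i l _ hw _ ha
  have h2 := hT.row_le hkl hb hw
  obtain rfl : w = a + 1 := by omega
  exact hw

/-- In a row, paired a + 1's lie left of all unpaired boxes and paired a's lie right of them. The
unpaired boxes thus fill an interval of columns, so reflecting it makes sense. -/
theorem IsUnpaired.between (hlam : Antitone lam) (hT : IsReverseTableau T) {i k l n : ℕ}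
    (hkl : k < l) (hln : l < n) (hk : IsUnpaired T a i k) (hn : IsUnpaired T a i n) :
    IsUnpaired T a i l := by
  have hle : ∀ z ∈ T.entries i l, z ≤ a + 1 ∧ (z = a + 1 → a + 1 ∈ T.entries i k) := by
    intro z hz
    rcases hk.1 with h | h
    · have := hT.row_le hkl h hz
      exact ⟨by omega, fun _ => by omega⟩
    · have := hT.row_le hkl h hz
      exact ⟨this, fun _ => h⟩
  have hge : ∀ z ∈ T.entries i l, a ≤ z ∧ (z = a → a ∈ T.entries i n) := by
    intro z hz
    rcases hn.1 with h | h
    · have := hT.row_le hln hz h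
      exact ⟨this, fun _ => h⟩
    · have := hT.row_le hln hz h
      exact ⟨by omega, fun _ => by omega⟩
  refine ⟨?_, ?_, ?_⟩
  · obtain ⟨z, hz⟩ := (T.nonempty_iff i l).2 (hln.trans hn.lt)
    have h1 := (hle z hz).1
    have h2 := (hge z hz).1
    rcases (show z = a ∨ z = a + 1 by omega) with rfl | rfl
    · exact Or.inl hz
    · exact Or.inr hz
  · rintro ⟨hb, ha⟩
    have hb' := (hle _ hb).2 rfl
    exact hk.2.1 ⟨hb', hT.pair_left hkl hb' ha⟩
  · rintro i' rfl ⟨ha, hb⟩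
    have ha' := (hge _ ha).2 rfl
    exact hn.2.2 i' rfl ⟨ha', hT.pair_right hlam hln hb ha'⟩

theorem isUnpaired_iff (hlam : Antitone lam) (hT : IsReverseTableau T) {i k : ℕ}
    (hk : IsUnpaired T a i k) (l : ℕ) : IsUnpaired T a i l ↔
      sInf {k | IsUnpaired T a i k} ≤ l ∧ l ≤ sSup {k | IsUnpaired T a i k} := by
  have hbdd : BddAbove {k | IsUnpaired T a i k} := ⟨lam i, fun k hk => hk.lt.le⟩
  have hne : {k | IsUnpaired T a i k}.Nonempty := ⟨k, hk⟩
  constructor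
  · exact fun hl => ⟨Nat.sInf_le hl, le_csSup hbdd hl⟩
  · rintro ⟨h1, h2⟩
    have hinf : IsUnpaired T a i _ := Nat.sInf_mem hne
    have hsup : IsUnpaired T a i _ := Nat.sSup_mem hne hbdd
    rcases h1.eq_or_lt with rfl | h1
    · exact hinf
    rcases h2.eq_or_lt with rfl | h2
    · exact hsup
    exact hinf.between hlam hT h1 h2 hsup

theorem IsUnpaired.reflectCol (hlam : Antitone lam) (hT : IsReverseTableau T) {i k : ℕ}
    (hk : IsUnpaired T a i k) : IsUnpaired T a i (reflectCol T a i k) := by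
  have h1 := (isUnpaired_iff hlam hT hk k).1 hk
  rw [isUnpaired_iff hlam hT hk, Skyline.reflectCol]
  omega

theorem IsUnpaired.reflectCol_reflectCol (hlam : Antitone lam) (hT : IsReverseTableau T)
    {i k : ℕ} (hk : IsUnpaired T a i k) :
    Skyline.reflectCol T a i (Skyline.reflectCol T a i k) = k := by
  have h1 := (isUnpaired_iff hlam hT hk k).1 hk
  rw [Skyline.reflectCol, Skyline.reflectCol]
  omega

theorem IsUnpaired.reflectCol_lt (hlam : Antitone lam) (hT : IsReverseTableau T) {i k l : ℕ}
    (hk : IsUnpaired T a i k) (hl : IsUnpaired T a i l) (hkl : k < l) :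
    Skyline.reflectCol T a i l < Skyline.reflectCol T a i k := by
  have h1 := (isUnpaired_iff hlam hT hk k).1 hk
  have h2 := (isUnpaired_iff hlam hT hk l).1 hl
  rw [Skyline.reflectCol, Skyline.reflectCol]
  omega

/-- Membership in the boxes of the Bender–Knuth transform of `T`: the unpaired boxes of each row
are reflected, with `a` and `a + 1` exchanged. -/
def BenderKnuthMem (T : SetFilling lam) (a i k x : ℕ) : Prop :=
  (x ∈ T.entries i k ∧ (IsUnpaired T a i k → x ≠ a ∧ x ≠ a + 1)) ∨
    (IsUnpaired T a i k ∧
      ((x = a ∧ a + 1 ∈ T.entries i (reflectCol T a i k)) ∨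
        (x = a + 1 ∧ a ∈ T.entries i (reflectCol T a i k))))

open scoped Classical in
/-- The Bender–Knuth transform of a set-valued reverse tableau. -/
noncomputable def benderKnuth (hlam : Antitone lam) (hT : IsReverseTableau T) (a : ℕ) :
    SetFilling lam where
  entries i k := (T.entries i k ∪ {a, a + 1}).filter (BenderKnuthMem T a i k)
  nonempty_iff i k := by
    by_cases hk : IsUnpaired T a i k
    · refine iff_of_true ?_ hk.lt
      rcases (hk.reflectCol hlam hT).1 with h | h
      · exact ⟨a + 1, by simp [BenderKnuthMem, hk, h]⟩
      · exact ⟨a, by simp [BenderKnuthMem, hk, h]⟩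
    · rw [← T.nonempty_iff]
      constructor
      · rintro ⟨x, hx⟩
        rcases (Finset.mem_filter.1 hx).2 with h | h
        · exact ⟨x, h.1⟩
        · exact absurd h.1 hk
      · rintro ⟨x, hx⟩
        exact ⟨x, Finset.mem_filter.2 ⟨Finset.mem_union_left _ hx,
          Or.inl ⟨hx, fun h => absurd h hk⟩⟩⟩

variable {hlam : Antitone lam} {hT : IsReverseTableau T}

theorem mem_benderKnuth {i k x : ℕ} :
    x ∈ (benderKnuth hlam hT a).entries i k ↔ BenderKnuthMem T a i k x := by
  classical
  refine ⟨fun h => (Finset.mem_filter.1 h).2, fun h => Finset.mem_filter.2 ⟨?_, h⟩⟩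
  rcases h with ⟨h, -⟩ | ⟨-, ⟨rfl, -⟩ | ⟨rfl, -⟩⟩
  · exact Finset.mem_union_left _ h
  · simp
  · simp

theorem mem_benderKnuth_of_ne {i k x : ℕ} (h1 : x ≠ a) (h2 : x ≠ a + 1) :
    x ∈ (benderKnuth hlam hT a).entries i k ↔ x ∈ T.entries i k := by
  rw [mem_benderKnuth, BenderKnuthMem]
  tauto

theorem mem_benderKnuth_of_not_isUnpaired {i k x : ℕ} (h : ¬ IsUnpaired T a i k) :
    x ∈ (benderKnuth hlam hT a).entries i k ↔ x ∈ T.entries i k := by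
  rw [mem_benderKnuth, BenderKnuthMem]
  tauto

theorem left_mem_benderKnuth {i k : ℕ} (h : IsUnpaired T a i k) :
    a ∈ (benderKnuth hlam hT a).entries i k ↔ a + 1 ∈ T.entries i (reflectCol T a i k) := by
  rw [mem_benderKnuth, BenderKnuthMem]
  have : a ≠ a + 1 := by omega
  tauto

theorem right_mem_benderKnuth {i k : ℕ} (h : IsUnpaired T a i k) :
    a + 1 ∈ (benderKnuth hlam hT a).entries i k ↔ a ∈ T.entries i (reflectCol T a i k) := by
  rw [mem_benderKnuth, BenderKnuthMem]
  have : a + 1 ≠ a := by omega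
  tauto

theorem exists_paired_of_right_mem (hT : IsReverseTableau T) {i k : ℕ}
    (h : a + 1 ∈ T.entries i k) (hk : ¬ IsUnpaired T a i k) : a ∈ T.entries (i + 1) k := by
  by_contra hne
  refine hk ⟨Or.inr h, fun h' => hne h'.2, ?_⟩
  rintro i' rfl ⟨-, h'⟩
  exact absurd (hT.column i' k _ h' _ h) (lt_irrefl _)

theorem exists_paired_of_left_mem (hT : IsReverseTableau T) {i k : ℕ}
    (h : a ∈ T.entries i k) (hk : ¬ IsUnpaired T a i k) :
    ∃ i', i' + 1 = i ∧ a + 1 ∈ T.entries i' k := by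
  by_contra! hne
  exact hk ⟨Or.inl h, fun h' => absurd (hT.column i k _ h _ h'.2) (lt_irrefl _),
    fun i' hi' h' => hne i' hi' h'.2⟩

/-- Within an unpaired interval, reflection together with exchanging a and a + 1 preserves weak
decrease. At its ends a violation would need an a left of an a + 1, one of them paired, which the
pairing lemmas exclude. Vertically, the boxes above and below an unpaired box contain neither a nor
a + 1. -/
theorem benderKnuth_isReverseTableau : IsReverseTableau (benderKnuth hlam hT a) := by
  constructor
  · intro i k x hx y hy
    by_cases hxk : IsUnpaired T a i k ∧ (x = a ∨ x = a + 1)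
    · obtain ⟨hk, hx'⟩ := hxk
      by_cases hyl : IsUnpaired T a i (k + 1) ∧ (y = a ∨ y = a + 1)
      · obtain ⟨hl, hy'⟩ := hyl
        rcases hx' with rfl | rfl
        · rcases hy' with rfl | rfl
          · exact le_rfl
          · rw [left_mem_benderKnuth hk] at hx
            rw [right_mem_benderKnuth hl] at hy
            -- Undoing the reflection of an a followed by an a + 1 gives an a left of an a + 1 in T.
            have := hT.row_le (hk.reflectCol_lt hlam hT hl (Nat.lt_succ_self k)) hy hx
            omega
        · omega
      · have hyT : y ∈ T.entries i (k + 1) := by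
          by_cases hl : IsUnpaired T a i (k + 1)
          · exact (mem_benderKnuth_of_ne (by tauto) (by tauto)).1 hy
          · exact (mem_benderKnuth_of_not_isUnpaired hl).1 hy
        have hyb : y ≤ a + 1 := by
          rcases hk.1 with h | h
          · have := hT.row i k _ h _ hyT
            omega
          · exact hT.row i k _ h _ hyT
        by_contra! hlt
        obtain ⟨rfl, rfl⟩ : x = a ∧ y = a + 1 := by omega
        have hl : ¬ IsUnpaired T x i (k + 1) := by tauto
        have hp := exists_paired_of_right_mem hT hyT hl
        have hb : x + 1 ∈ T.entries i k := by
          rcases hk.1 with h | h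
          · have := hT.row i k _ h _ hyT
            omega
          · exact h
        exact hk.2.1 ⟨hb, hT.pair_left (Nat.lt_succ_self k) hb hp⟩
    · have hxT : x ∈ T.entries i k := by
        by_cases hk : IsUnpaired T a i k
        · exact (mem_benderKnuth_of_ne (by tauto) (by tauto)).1 hx
        · exact (mem_benderKnuth_of_not_isUnpaired hk).1 hx
      by_cases hyl : IsUnpaired T a i (k + 1) ∧ (y = a ∨ y = a + 1)
      · obtain ⟨hl, hy'⟩ := hyl
        have hxa : a ≤ x := by
          rcases hl.1 with h | h
          · exact hT.row i k _ hxT _ h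
          · have := hT.row i k _ hxT _ h
            omega
        by_contra! hlt
        obtain ⟨rfl, rfl⟩ : x = a ∧ y = a + 1 := by omega
        have hk : ¬ IsUnpaired T x i k := by tauto
        obtain ⟨i', rfl, hb⟩ := exists_paired_of_left_mem hT hxT hk
        have ha : x ∈ T.entries (i' + 1) (k + 1) := by
          rcases hl.1 with h | h
          · exact h
          · have := hT.row _ k _ hxT _ h
            omega
        exact hl.2.2 i' rfl ⟨ha, hT.pair_right hlam (Nat.lt_succ_self k) hb ha⟩
      · have hyT : y ∈ T.entries i (k + 1) := by
          by_cases hl : IsUnpaired T a i (k + 1)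
          · exact (mem_benderKnuth_of_ne (by tauto) (by tauto)).1 hy
          · exact (mem_benderKnuth_of_not_isUnpaired hl).1 hy
        exact hT.row i k x hxT y hyT
  · intro i k x hx y hy
    by_cases hk : IsUnpaired T a i k
    · obtain ⟨h1, h2⟩ := hk.notMem_below hT
      have hl : ¬ IsUnpaired T a (i + 1) k := fun h => h.1.elim h1 h2
      rw [mem_benderKnuth_of_not_isUnpaired hl] at hy
      have hyn : y ≠ a ∧ y ≠ a + 1 := ⟨fun h => h1 (h ▸ hy), fun h => h2 (h ▸ hy)⟩
      by_cases hxa : x = a ∨ x = a + 1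
      · have : y < a + 1 := by
          rcases hk.1 with h | h
          · have := hT.column i k _ h _ hy
            omega
          · exact hT.column i k _ h _ hy
        omega
      · rw [mem_benderKnuth_of_ne (by tauto) (by tauto)] at hx
        exact hT.column i k x hx y hy
    · rw [mem_benderKnuth_of_not_isUnpaired hk] at hx
      by_cases hl : IsUnpaired T a (i + 1) k
      · obtain ⟨h1, h2⟩ := hl.notMem_above hT
        have hxn : x ≠ a ∧ x ≠ a + 1 := ⟨fun h => h1 (h ▸ hx), fun h => h2 (h ▸ hx)⟩
        by_cases hya : y = a ∨ y = a + 1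
        · have : a < x := by
            rcases hl.1 with h | h
            · exact hT.column i k _ hx _ h
            · have := hT.column i k _ hx _ h
              omega
          omega
        · rw [mem_benderKnuth_of_ne (by tauto) (by tauto)] at hy
          exact hT.column i k x hx y hy
      · rw [mem_benderKnuth_of_not_isUnpaired hl] at hy
        exact hT.column i k x hx y hy

/-- Paired boxes and the neighbours above and below unpaired ones keep their a's and a + 1's, so no
pair is created or destroyed. This makes the transform an involution. -/
theorem isUnpaired_benderKnuth {i k : ℕ} :
    IsUnpaired (benderKnuth hlam hT a) a i k ↔ IsUnpaired T a i k := by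
  constructor
  · intro h
    by_contra hk
    have h1 := h.1
    rw [mem_benderKnuth_of_not_isUnpaired hk, mem_benderKnuth_of_not_isUnpaired hk] at h1
    rcases h1 with h1 | h1
    · obtain ⟨i', rfl, hb⟩ := exists_paired_of_left_mem hT h1 hk
      have hi' : ¬ IsUnpaired T a i' k := fun h => (h.notMem_below hT).1 h1
      exact h.2.2 i' rfl ⟨(mem_benderKnuth_of_not_isUnpaired hk).2 h1,
        (mem_benderKnuth_of_not_isUnpaired hi').2 hb⟩
    · have ha := exists_paired_of_right_mem hT h1 hk
      have hi' : ¬ IsUnpaired T a (i + 1) k := fun h => (h.notMem_above hT).2 h1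
      exact h.2.1 ⟨(mem_benderKnuth_of_not_isUnpaired hk).2 h1,
        (mem_benderKnuth_of_not_isUnpaired hi').2 ha⟩
  · intro hk
    refine ⟨?_, ?_, ?_⟩
    · rw [left_mem_benderKnuth hk, right_mem_benderKnuth hk, or_comm]
      exact (hk.reflectCol hlam hT).1
    · rintro ⟨-, h⟩
      obtain ⟨h1, h2⟩ := hk.notMem_below hT
      have hl : ¬ IsUnpaired T a (i + 1) k := fun h => h.1.elim h1 h2
      exact h1 ((mem_benderKnuth_of_not_isUnpaired hl).1 h)
    · rintro i' rfl ⟨-, h⟩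
      obtain ⟨h1, h2⟩ := hk.notMem_above hT
      have hl : ¬ IsUnpaired T a i' k := fun h => h.1.elim h1 h2
      exact h2 ((mem_benderKnuth_of_not_isUnpaired hl).1 h)

theorem reflectCol_benderKnuth (i k : ℕ) :
    reflectCol (benderKnuth hlam hT a) a i k = reflectCol T a i k := by
  simp only [reflectCol, isUnpaired_benderKnuth]

theorem benderKnuth_benderKnuth :
    benderKnuth hlam (benderKnuth_isReverseTableau (hlam := hlam) (hT := hT) (a := a)) a = T := by
  refine SetFilling.ext (funext fun i => funext fun k => ?_)
  ext x
  by_cases hk : IsUnpaired T a i k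
  · have hk' := (isUnpaired_benderKnuth (hlam := hlam) (hT := hT)).2 hk
    have hkr := hk.reflectCol hlam hT
    rcases eq_or_ne x a with rfl | h1
    · rw [left_mem_benderKnuth hk', reflectCol_benderKnuth, right_mem_benderKnuth hkr,
        hk.reflectCol_reflectCol hlam hT]
    rcases eq_or_ne x (a + 1) with rfl | h2
    · rw [right_mem_benderKnuth hk', reflectCol_benderKnuth, left_mem_benderKnuth hkr,
        hk.reflectCol_reflectCol hlam hT]
    rw [mem_benderKnuth_of_ne h1 h2, mem_benderKnuth_of_ne h1 h2]
  · rw [mem_benderKnuth_of_not_isUnpaired (isUnpaired_benderKnuth.not.2 hk),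
      mem_benderKnuth_of_not_isUnpaired hk]

/-- Reflection matches the unpaired occurrences; a paired a is matched with the a + 1 directly above
it. -/
theorem content_benderKnuth_left : (benderKnuth hlam hT a).content a = T.content (a + 1) := by
  classical
  rw [content_apply, content_apply]
  -- The truncated subtraction is harmless: a paired a has a box above it, so its row is positive.
  refine Set.ncard_congr (fun p _ => if IsUnpaired T a p.1 p.2 then
    (p.1, reflectCol T a p.1 p.2) else (p.1 - 1, p.2)) ?_ ?_ ?_
  · rintro ⟨i, k⟩ h
    change a ∈ (benderKnuth hlam hT a).entries i k at h
    dsimp only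
    split_ifs with hk
    · exact (left_mem_benderKnuth hk).1 h
    · rw [mem_benderKnuth_of_not_isUnpaired hk] at h
      obtain ⟨i', rfl, hb⟩ := exists_paired_of_left_mem hT h hk
      exact hb
  · rintro ⟨i, k⟩ ⟨j, l⟩ h h' e
    change a ∈ (benderKnuth hlam hT a).entries i k at h
    change a ∈ (benderKnuth hlam hT a).entries j l at h'
    have aux : ∀ {i k}, a ∈ (benderKnuth hlam hT a).entries i k → ¬ IsUnpaired T a i k →
        1 ≤ i ∧ ¬ IsUnpaired T a (i - 1) k := by
      intro i k h hk
      rw [mem_benderKnuth_of_not_isUnpaired hk] at h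
      obtain ⟨i', rfl, hb⟩ := exists_paired_of_left_mem hT h hk
      exact ⟨by omega, fun h' => (h'.notMem_below hT).1 h⟩
    dsimp only at e
    split_ifs at e with hk hl hl
    · obtain ⟨rfl, e⟩ := Prod.mk.inj e
      rw [← hk.reflectCol_reflectCol hlam hT, e, hl.reflectCol_reflectCol hlam hT]
    · obtain ⟨e1, e2⟩ := Prod.mk.inj e
      have := (aux h' hl).2
      rw [← e1, ← e2] at this
      exact absurd (hk.reflectCol hlam hT) this
    · obtain ⟨e1, e2⟩ := Prod.mk.inj e
      have := (aux h hk).2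
      rw [e1, e2] at this
      exact absurd (hl.reflectCol hlam hT) this
    · obtain ⟨e1, rfl⟩ := Prod.mk.inj e
      have h1 := (aux h hk).1
      have h2 := (aux h' hl).1
      rw [Prod.mk.injEq]
      omega
  · rintro ⟨i, k⟩ h
    change a + 1 ∈ T.entries i k at h
    by_cases hk : IsUnpaired T a i k
    · have hkr := hk.reflectCol hlam hT
      have hkk := hk.reflectCol_reflectCol hlam hT
      refine ⟨(i, reflectCol T a i k), ?_, ?_⟩
      · change a ∈ (benderKnuth hlam hT a).entries i _
        rw [left_mem_benderKnuth hkr, hkk]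
        exact h
      · dsimp only
        rw [if_pos hkr, hkk]
    · have ha := exists_paired_of_right_mem hT h hk
      have hk' : ¬ IsUnpaired T a (i + 1) k := fun h' => (h'.notMem_above hT).2 h
      refine ⟨(i + 1, k), (mem_benderKnuth_of_not_isUnpaired hk').2 ha, ?_⟩
      dsimp only
      rw [if_neg hk', Nat.add_sub_cancel]

theorem content_benderKnuth :
    (benderKnuth hlam hT a).content = T.content.mapDomain (Equiv.swap a (a + 1)) := by
  ext j
  obtain ⟨j, rfl⟩ := (Equiv.swap a (a + 1)).surjective j
  rw [Finsupp.mapDomain_apply (Equiv.injective _)]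
  rcases eq_or_ne j a with rfl | h1
  · rw [Equiv.swap_apply_left]
    -- Applying the count to the transform and using the involution gives the multiplicity of j + 1.
    have := content_benderKnuth_left (hlam := hlam) (a := j)
      (hT := benderKnuth_isReverseTableau (hlam := hlam) (hT := hT) (a := j))
    rw [benderKnuth_benderKnuth] at this
    exact this.symm
  rcases eq_or_ne j (a + 1) with rfl | h2
  · rw [Equiv.swap_apply_right, content_benderKnuth_left]
  rw [Equiv.swap_apply_of_ne_of_ne h1 h2, content_apply, content_apply]
  simp only [mem_benderKnuth_of_ne h1 h2]

variable {R : Type*} [CommRing R]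

theorem isClassInvariant_grothendieck (β : R) (lam : Partition) :
    IsClassInvariant partitionOf (grothendieck β lam) := by
  refine isClassInvariant_partitionOf fun a m => ?_
  change ∑ᶠ T : SetRT lam.1, MvPowerSeries.coeff _ (fillingTerm β T.1) =
    ∑ᶠ T : SetRT lam.1, MvPowerSeries.coeff _ (fillingTerm β T.1)
  let e : SetRT lam.1 → SetRT lam.1 := fun T =>
    ⟨benderKnuth lam.2 T.2 a, benderKnuth_isReverseTableau⟩
  have he : Function.Involutive e := fun T =>
    Subtype.ext (benderKnuth_benderKnuth (hlam := lam.2) (hT := T.2))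
  refine (finsum_eq_of_bijective e he.bijective fun T => ?_).symm
  have hinj : Function.Injective (Equiv.swap a (a + 1)) := Equiv.injective _
  have hdeg : (T.1.content.mapDomain (Equiv.swap a (a + 1))).degree = T.1.content.degree := by
    rw [degree_eq_sum_parts, parts_mapDomain hinj, ← degree_eq_sum_parts]
  classical
  simp only [e, fillingTerm, content_benderKnuth, hdeg, MvPowerSeries.coeff_monomial,
    (Finsupp.mapDomain_injective hinj).eq_iff]

end BenderKnuth

end Skyline

/-! ### The proposition for both class maps -/

theorem proposition1p5 {R : Type*} [CommRing R] [PartialOrder R] [IsOrderedRing R] (β : R)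
    (c : Skyline.WeakComp → R) (f : MvPowerSeries ℕ R)
    (hf : Skyline.HasFormalSum (fun γ => c γ • Skyline.lascouxAtom β γ) f) :
    (Skyline.IsQuasisymmetric f ↔
      ∀ γ δ : Skyline.WeakComp, Skyline.plus γ = Skyline.plus δ → c γ = c δ) ∧
    (Skyline.IsSymmetric f ↔
      ∀ γ δ : Skyline.WeakComp, Skyline.partitionOf γ = Skyline.partitionOf δ → c γ = c δ) ∧
    (Skyline.IsQuasisymmetric f →
      (Skyline.IsPositiveIn (Skyline.quasiGrothendieck β) f ↔
        Skyline.IsPositiveIn (Skyline.lascouxAtom β) f)) ∧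
    (Skyline.IsSymmetric f →
      (Skyline.IsPositiveIn (Skyline.grothendieck β) f ↔
        Skyline.IsPositiveIn (Skyline.lascouxAtom β) f)) := by
  have hL := Skyline.lascouxAtom_isTriangular β
  have hdeg : ∀ {γ δ : Skyline.WeakComp}, Skyline.parts γ = Skyline.parts δ →
      γ.degree = δ.degree := fun h => by
    rw [Skyline.degree_eq_sum_parts, h, Skyline.degree_eq_sum_parts]
  have hsq : ∀ {γ δ : Skyline.WeakComp}, Skyline.parts γ = Skyline.parts δ →
      Skyline.sumSq γ = Skyline.sumSq δ := fun h => by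
    rw [Skyline.sumSq_eq_sum_parts, h, Skyline.sumSq_eq_sum_parts]
  -- The class map takes values in `Skyline.Comp`, so that classes are indexed exactly as the
  -- functions 𝒢_α are.
  let cls : Skyline.WeakComp → Skyline.Comp := fun γ => ⟨Skyline.plus γ, fun a ha => by
    refine Nat.pos_of_ne_zero fun h => Skyline.zero_notMem_parts γ ?_
    rw [← Skyline.coe_plus, ← h]
    exact ha⟩
  have hcls : ∀ {γ δ}, cls γ = cls δ ↔ Skyline.plus γ = Skyline.plus δ := Subtype.mk_eq_mk
  have hqparts : ∀ {γ δ}, cls γ = cls δ → Skyline.parts γ = Skyline.parts δ := fun h =>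
    Skyline.parts_eq_of_plus_eq (hcls.1 h)
  have hqG : ∀ α m, MvPowerSeries.coeff m (Skyline.quasiGrothendieck β α) =
      ∑ᶠ γ : {γ // cls γ = α}, MvPowerSeries.coeff m (Skyline.lascouxAtom β γ.1) := fun α m =>
    (finsum_comp_equiv (Equiv.subtypeEquivRight fun γ =>
      (Subtype.ext_iff : cls γ = α ↔ Skyline.plus γ = α.1))
      (f := fun γ => MvPowerSeries.coeff m (Skyline.lascouxAtom β γ.1))).symm
  have hqinv : ∀ α, Skyline.IsClassInvariant cls (Skyline.quasiGrothendieck β α) :=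
    fun α m m' h => Skyline.isClassInvariant_quasiGrothendieck β α m m' (hcls.1 h)
  have hq : Skyline.IsQuasisymmetric f ↔ Skyline.IsClassInvariant cls f :=
    Skyline.isQuasisymmetric_iff.trans (by simp only [Skyline.IsClassInvariant, hcls])
  have hsparts : ∀ {γ δ}, Skyline.partitionOf γ = Skyline.partitionOf δ →
      Skyline.parts γ = Skyline.parts δ := Skyline.parts_eq_of_partitionOf_eq
  refine ⟨?_, ?_, fun hfq => ?_, fun hfs => ?_⟩
  · rw [hq, hL.invariant_iff (fun _ _ h => hdeg (hqparts h)) (fun _ _ h => hsq (hqparts h))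
      hqG hqinv hf]
    simp only [hcls]
  · rw [Skyline.isSymmetric_iff]
    exact hL.invariant_iff (fun _ _ h => hdeg (hsparts h)) (fun _ _ h => hsq (hsparts h))
      (Skyline.coeff_grothendieck β) (Skyline.isClassInvariant_grothendieck β) hf
  · exact hL.positive_iff (fun _ _ h => hdeg (hqparts h)) (fun _ _ h => hsq (hqparts h))
      hqG hqinv (hq.1 hfq)
  · exact hL.positive_iff (fun _ _ h => hdeg (hsparts h)) (fun _ _ h => hsq (hsparts h))
      (Skyline.coeff_grothendieck β) (Skyline.isClassInvariant_grothendieck β)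
      (Skyline.isSymmetric_iff.1 hfs)
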